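/- Let $\mathrm{Ai}(x)=\frac1\pi\int_0^{+\infty}\cos\bigl(\tfrac{t^3}{3}+xt\bigr)\,dt$ be the Airy function (a conditionally convergent integral) and let $$\mathscr A(x,y)=\frac{\mathrm{Ai}(x)\mathrm{Ai}'(y)-\mathrm{Ai}(y)\mathrm{Ai}'(x)}{x-y},\qquad \mathscr A(x,x)=\mathrm{Ai}'(x)^2-x\,\mathrm{Ai}(x)^2,$$ be the Airy kernel. The symplectic Airy matrix kernel of Tracy and Widom is $\mathscr A^{(4)}=(\mathscr A^{(4)}_{ij})_{i,j=1,2}$, where $$\mathscr A^{(4)}_{11}(x,y)=-\frac12\int_x^{+\infty}\mathscr A(u,y)\,du+\frac14\int_x^{+\infty}\mathrm{Ai}(u)\,du\int_y^{+\infty}\mathrm{Ai}(v)\,dv,$$ $$\mathscr A^{(4)}_{22}(x,y)=\frac12\,\partial_y\mathscr A(x,y)+\frac14\,\mathrm{Ai}(x)\mathrm{Ai}(y),$$ $$\mathscr A^{(4)}_{12}(x,y)=-\mathscr A^{(4)}_{21}(y,x)=\frac12\,\mathscr A(x,y)-\frac14\,\mathrm{Ai}(y)\int_x^{+\infty}\mathrm{Ai}(u)\,du.$$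 Let $\mathbb P_{\mathscr A^{(4)}}$ be the Pfaffian point process on $\mathbb R$ induced by this kernel, that is, a probability measure on the space of locally finite configurations on $\mathbb R$ whose correlation functions with respect to Lebesgue measure are $$\rho_n(x_1,\dots,x_n)=\mathrm{Pf}\bigl(\mathscr A^{(4)}(x_i,x_j)\bigr)_{i,j=1,\dots,n},\qquad n\ge 0,$$ and let $\#_I$ be the number of particles in $I$. Then for every $a\in\mathbb R$ and every $L>0$ there exists a constant $d>0$, depending only on $a$ and $L$, such that for every compact interval $I\subset(a,+\infty)$ of length $L$ and every $\lambda>0$, $$\mathbb E_{\mathbb P_{\mathscr A^{(4)}}}\exp\bigl(\lambda\,\#_I^2\bigr)\le\exp\bigl(d\,(e^{3\lambda/2}-1)\bigr).$$ -/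

import Mathlib

open MeasureTheory Filter

/-- The Pfaffian `Pf M` of an antisymmetric `2n × 2n` matrix. Rows and columns are indexed by
`Fin n × Fin 2` in lexicographic order, so that `(i, 0)` and `(i, 1)` stand for the
positions `2i - 1` and `2i` of the usual formula
`Pf M = (2ⁿ n!)⁻¹ ∑_σ sgn σ ∏ᵢ M_{σ(2i-1), σ(2i)}`. -/
noncomputable def pfaffian {n : ℕ} (M : Matrix (Fin n × Fin 2) (Fin n × Fin 2) ℝ) : ℝ :=
  (2 ^ n * (n.factorial : ℝ))⁻¹ *
    ∑ σ : Equiv.Perm (Fin n × Fin 2),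
      ((Equiv.Perm.sign σ : ℤ) : ℝ) * ∏ i : Fin n, M (σ (i, 0)) (σ (i, 1))

/-- A configuration on `ℝ`: a collection of particles, possibly with multiplicities, only finitely
many of which lie in any bounded set. It is given by the multiplicity of each point. -/
structure Configuration where
  mult : ℝ → ℕ
  locallyFinite : ∀ B : Set ℝ, Bornology.IsBounded B → {x ∈ B | mult x ≠ 0}.Finite

namespace Configuration

/-- `#_B(X)`: the number of particles of `X` in `B`, with multiplicities (used for bounded `B`,
where the sum is finite). -/
noncomputable def count (B : Set ℝ) (X : Configuration) : ℕ :=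
  ∑ᶠ x ∈ B, X.mult x

/-- The σ-algebra on configurations generated by the particle numbers in bounded Borel sets. -/
noncomputable instance instMeasurableSpace : MeasurableSpace Configuration :=
  ⨆ B ∈ {B : Set ℝ | MeasurableSet B ∧ Bornology.IsBounded B},
    MeasurableSpace.comap (count B) ⊤

end Configuration

/-- The functions `ρ n` on `ℝⁿ` are the correlation functions of the point process `P`:
`ρ n ≥ 0` almost everywhere and, for pairwise disjoint bounded Borel sets `B₁, …, B_l` and integers
`k₁ + ⋯ + k_l = n`, the expectation of `∏ᵢ #_{Bᵢ} (#_{Bᵢ} - 1) ⋯ (#_{Bᵢ} - kᵢ + 1)` is the integral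
of `ρ n` over the product of the `Bᵢ ^ kᵢ`. The factors of this product are labelled by
`c : Fin n → Fin l`: the `j`-th coordinate ranges over `B (c j)`, and `kᵢ` is the number of `j`
with `c j = i`. -/
def HasCorrelationFunctions (P : Measure Configuration) (ρ : (n : ℕ) → (Fin n → ℝ) → ℝ) : Prop :=
  (∀ n : ℕ, ∀ᵐ x : Fin n → ℝ, 0 ≤ ρ n x) ∧
  ∀ (n l : ℕ) (B : Fin l → Set ℝ) (c : Fin n → Fin l),
    (∀ i, MeasurableSet (B i)) → (∀ i, Bornology.IsBounded (B i)) →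
    (∀ i j, i ≠ j → Disjoint (B i) (B j)) →
    ∫⁻ X, ∏ i : Fin l,
        ((Nat.descFactorial (X.count (B i)) (Fintype.card {j : Fin n // c j = i}) : ℕ) : ENNReal) ∂P
      = ∫⁻ x in Set.univ.pi (fun j => B (c j)), ENNReal.ofReal (ρ n x)

/-- `P` is the Pfaffian point process on `ℝ` with the `2 × 2` matrix kernel `K`: a probability
measure on configurations with correlation functions
`ρ_n(x₁, …, x_n) = Pf (K(xᵢ, xⱼ))_{i, j = 1, …, n}`. -/
def IsPfaffianPointProcess (P : Measure Configuration)
    (K : ℝ → ℝ → Matrix (Fin 2) (Fin 2) ℝ) : Prop :=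
  IsProbabilityMeasure P ∧
  HasCorrelationFunctions P fun _ x =>
    pfaffian (Matrix.of fun p q => K (x p.1) (x q.1) p.2 q.2)

/-- The Airy function `Ai(x) = π⁻¹ ∫₀^∞ cos(t³/3 + xt) dt`; the integral converges only
conditionally and is the limit of the integrals over `[0, T]` as `T → ∞`. -/
noncomputable def airyAi (x : ℝ) : ℝ :=
  Real.pi⁻¹ * limUnder atTop (fun T : ℝ => ∫ t in (0 : ℝ)..T, Real.cos (t ^ 3 / 3 + x * t))

/-- The Airy kernel `(Ai(x) Ai'(y) - Ai(y) Ai'(x)) / (x - y)`, with its continuous extension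
`Ai'(x)² - x Ai(x)²` to the diagonal. -/
noncomputable def airyKernel (x y : ℝ) : ℝ :=
  if x = y then deriv airyAi x ^ 2 - x * airyAi x ^ 2
  else (airyAi x * deriv airyAi y - airyAi y * deriv airyAi x) / (x - y)

/-- `∫_x^∞ Ai(u) du`. -/
noncomputable def airyTail (x : ℝ) : ℝ := ∫ u in Set.Ioi x, airyAi u

/-- The `(1,1)` entry of the symplectic Airy kernel. -/
noncomputable def symplecticAiry₁₁ (x y : ℝ) : ℝ :=
  -(1 / 2) * (∫ u in Set.Ioi x, airyKernel u y) + 1 / 4 * airyTail x * airyTail y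

/-- The `(1,2)` entry of the symplectic Airy kernel. -/
noncomputable def symplecticAiry₁₂ (x y : ℝ) : ℝ :=
  1 / 2 * airyKernel x y - 1 / 4 * airyAi y * airyTail x

/-- The `(2,2)` entry of the symplectic Airy kernel. -/
noncomputable def symplecticAiry₂₂ (x y : ℝ) : ℝ :=
  1 / 2 * deriv (fun v => airyKernel x v) y + 1 / 4 * airyAi x * airyAi y

/-- The symplectic Airy matrix kernel of Tracy and Widom. -/
noncomputable def symplecticAiryKernel (x y : ℝ) : Matrix (Fin 2) (Fin 2) ℝ :=
  !![symplecticAiry₁₁ x y, symplecticAiry₁₂ x y;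
     -symplecticAiry₁₂ y x, symplecticAiry₂₂ x y]

/-! The tail of `#_I` is controlled by the decay of the correlation functions: the probability of
exactly `n` particles in `I` is at most `Lⁿ` times the supremum of `ρ_n` on `Iⁿ`
(`measure_count_eq_le`). With `t = exp (3λ/2)` and `N = n²`, the weight `exp (λ n²)` is
`(t ^ N) ^ (2/3)`, so it is enough that `ρ_n` is at most `(C ^ N / N!) ^ (2/3)`: then each term of
the expectation is at most `2⁻ⁿ exp (D t)` (`exists_weight_growth_le`), and splitting off
`exp (λ n²) - 1 ≤ (t - 1) n² exp (λ n²)` turns the sum into `1 + 2 (t - 1) exp (D t)`, which is at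
most `exp (d (t - 1))`.

The bound on `ρ_n` says that the Pfaffian is of size `n ^ (-4n²/3)` up to a factor `C ^ (n²)`. Put
`T(x) = ∫_x^∞ Ai`, `τ₀ = T` and `τ₁ = Ai = -T'`. All four entries of the kernel have the form
`½ ∫_0^∞ τ_a(x + z) τ_b'(y + z) dz + ¼ τ_a(x) τ_b(y)` (`symplecticAiryKernel_eq`), so they come from
a single entire function by differentiation in `x` and `y`. Expanding in Taylor series at the left
end point of the interval exhibits the matrix of the kernel as `V C Vᵀ`, where `V` is an infinite
confluent Vandermonde matrix and `C` is the matrix of Taylor coefficients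
(`tendsto_sum_kernelCoeff`). By a Cauchy–Binet formula (`pfaffian_congruence`) the Pfaffian is a sum
over selections of `2n` columns. Repeated columns contribute zero, so the selection of the first
`2n` columns dominates, and the Pfaffian is bounded by the product of the first `2n` weights
(`abs_pfaffian_congruence_le`).

The weights are of size `(k!)^(1/3) / k!`, which gives the exponent `4/3`, because the `k`-th
derivative of the Airy function grows like `(k!)^(1/3)`. This is seen by moving the contour of the
Airy integral to height `(k + 1)^(1/3)` (`airyAi_eq_neg_airyContour`, `abs_airyContour_le`).
-/

open scoped Topology

/-! ### The Airy integral on a shifted contour -/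

/-- The oscillating exponential `exp (i (z³ / 3 + x z))`, whose integral along a horizontal line in
the upper half-plane is `2π Ai(x)`. -/
noncomputable def airyPhase (x : ℝ) (z : ℂ) : ℂ :=
  Complex.exp (Complex.I * (z ^ 3 / 3 + x * z))

/-- The integrand `(i w)^(k - 1) exp (i (w³ / 3 + x w))`, `w = t + i η`, on the horizontal line at
height `η`. -/
noncomputable def airyIntegrand (η : ℝ) (k : ℕ) (x t : ℝ) : ℂ :=
  (Complex.I * (t + η * Complex.I)) ^ k / (Complex.I * (t + η * Complex.I)) *
    airyPhase x (t + η * Complex.I)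

/-- The `k`-th derivative of `x ↦ ∫_x^∞ Ai`, as an integral along the line of height `η`; it does
not depend on `η > 0`. -/
noncomputable def airyContour (η : ℝ) (k : ℕ) (x : ℝ) : ℝ :=
  -(2 * Real.pi)⁻¹ * (∫ t : ℝ, airyIntegrand η k x t).re

theorem norm_airyPhase (x t η : ℝ) :
    ‖airyPhase x (t + η * Complex.I)‖
      = Real.exp (η ^ 3 / 3 - x * η) * Real.exp (-η * t ^ 2) := by
  rw [airyPhase, Complex.norm_exp, ← Real.exp_add]
  congr 1
  have : Complex.I * (((t : ℂ) + η * Complex.I) ^ 3 / 3 + x * (t + η * Complex.I))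
      = ((η ^ 3 / 3 - x * η + -η * t ^ 2 : ℝ) : ℂ)
        + ((t ^ 3 / 3 - t * η ^ 2 + x * t : ℝ) : ℂ) * Complex.I := by
    have h2 : Complex.I ^ 2 = -1 := Complex.I_sq
    have h3 : Complex.I ^ 3 = -Complex.I := by rw [pow_succ, h2]; ring
    have h4 : Complex.I ^ 4 = 1 := by rw [pow_succ, h3]; simp
    push_cast
    ring_nf
    rw [h2, h3, h4]
    ring
  rw [this, Complex.add_re, Complex.ofReal_re, Complex.re_ofReal_mul, Complex.I_re]
  ring

theorem norm_line_sq (t η : ℝ) : ‖(t : ℂ) + η * Complex.I‖ ^ 2 = t ^ 2 + η ^ 2 := by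
  rw [Complex.sq_norm, Complex.normSq_apply]
  simp
  ring

theorem le_norm_line (t : ℝ) {η : ℝ} (hη : 0 < η) : η ≤ ‖(t : ℂ) + η * Complex.I‖ := by
  have := norm_line_sq t η
  nlinarith [norm_nonneg ((t : ℂ) + η * Complex.I), sq_nonneg t]

theorem line_ne_zero (t : ℝ) {η : ℝ} (hη : 0 < η) : (t : ℂ) + η * Complex.I ≠ 0 := by
  rw [← norm_pos_iff]
  exact hη.trans_le (le_norm_line t hη)

theorem norm_airyIntegrand (η : ℝ) (k : ℕ) (x t : ℝ) :
    ‖airyIntegrand η k x t‖ = ‖(t : ℂ) + η * Complex.I‖ ^ k / ‖(t : ℂ) + η * Complex.I‖ *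
      (Real.exp (η ^ 3 / 3 - x * η) * Real.exp (-η * t ^ 2)) := by
  rw [airyIntegrand, norm_mul, norm_airyPhase]
  simp

/-- Exponential growth along the line is absorbed by half of the Gaussian. -/
theorem exp_norm_line_mul_le {η : ℝ} (hη : 0 < η) {c : ℝ} (hc : 0 ≤ c) (t : ℝ) :
    Real.exp (c * ‖(t : ℂ) + η * Complex.I‖) * Real.exp (-η * t ^ 2)
      ≤ Real.exp (c * η + c ^ 2 / (2 * η)) * Real.exp (-(η / 2) * t ^ 2) := by
  rw [← Real.exp_add, ← Real.exp_add, Real.exp_le_exp]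
  have h1 : ‖(t : ℂ) + η * Complex.I‖ ≤ |t| + η := by
    refine (norm_add_le _ _).trans ?_
    simp [abs_of_pos hη]
  have h2 : c * |t| ≤ c ^ 2 / (2 * η) + η / 2 * t ^ 2 := by
    have : 0 ≤ (c - η * |t|) ^ 2 / (2 * η) := by positivity
    have h3 : (c - η * |t|) ^ 2 / (2 * η) = c ^ 2 / (2 * η) + η / 2 * t ^ 2 - c * |t| := by
      rw [← sq_abs t]
      field_simp
      ring
    linarith
  nlinarith [mul_le_mul_of_nonneg_left h1 hc]

/-- With `c = 0` this bounds the integrand itself; with `c = |h|` it dominates the power series in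
`h` of `exp (i h w)`. -/
theorem norm_airyIntegrand_mul_exp_le {η : ℝ} (hη : 0 < η) {c : ℝ} (hc : 0 ≤ c) (k : ℕ)
    (x t : ℝ) :
    ‖airyIntegrand η k x t‖ * Real.exp (c * ‖(t : ℂ) + η * Complex.I‖)
      ≤ k.factorial / η * Real.exp ((c + 1) * η + (c + 1) ^ 2 / (2 * η)) *
        Real.exp (η ^ 3 / 3 - x * η) * Real.exp (-(η / 2) * t ^ 2) := by
  rw [norm_airyIntegrand]
  set r := ‖(t : ℂ) + η * Complex.I‖ with hr
  have hrη : η ≤ r := le_norm_line t hη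
  have hr0 : 0 < r := hη.trans_le hrη
  have h1 : r ^ k / r ≤ k.factorial / η * Real.exp r := by
    have := Real.pow_div_factorial_le_exp r hr0.le k
    rw [div_le_iff₀ (by positivity)] at this
    calc r ^ k / r ≤ r ^ k / η := by gcongr
      _ ≤ Real.exp r * k.factorial / η := by gcongr
      _ = _ := by ring
  have h2 := exp_norm_line_mul_le hη (c := c + 1) (by positivity) t
  rw [← hr] at h2
  calc r ^ k / r * (Real.exp (η ^ 3 / 3 - x * η) * Real.exp (-η * t ^ 2)) * Real.exp (c * r)
      ≤ (k.factorial / η * Real.exp r) *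
        (Real.exp (η ^ 3 / 3 - x * η) * Real.exp (-η * t ^ 2)) * Real.exp (c * r) := by gcongr
    _ = (k.factorial / η) * Real.exp (η ^ 3 / 3 - x * η) *
        (Real.exp ((c + 1) * r) * Real.exp (-η * t ^ 2)) := by
        rw [add_mul, one_mul, Real.exp_add]; ring
    _ ≤ (k.factorial / η) * Real.exp (η ^ 3 / 3 - x * η) *
        (Real.exp ((c + 1) * η + (c + 1) ^ 2 / (2 * η)) * Real.exp (-(η / 2) * t ^ 2)) := by
        gcongr
    _ = _ := by ring

/-- The constant in the bound `airyConst η k * exp (-x η) * exp (-η t² / 2)` for the integrand. -/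
noncomputable def airyConst (η : ℝ) (k : ℕ) : ℝ :=
  k.factorial / η * Real.exp (η + 1 / (2 * η)) * Real.exp (η ^ 3 / 3)

theorem airyConst_pos {η : ℝ} (hη : 0 < η) (k : ℕ) : 0 < airyConst η k := by
  unfold airyConst; positivity

theorem norm_airyIntegrand_le {η : ℝ} (hη : 0 < η) (k : ℕ) (x t : ℝ) :
    ‖airyIntegrand η k x t‖
      ≤ airyConst η k * Real.exp (-x * η) * Real.exp (-(η / 2) * t ^ 2) := by
  have := norm_airyIntegrand_mul_exp_le hη le_rfl k x t
  simp only [zero_mul, Real.exp_zero, mul_one, zero_add, one_mul, one_pow] at this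
  refine this.trans_eq ?_
  have e : Real.exp (η ^ 3 / 3 - x * η) = Real.exp (η ^ 3 / 3) * Real.exp (-x * η) := by
    rw [← Real.exp_add, neg_mul, sub_eq_add_neg]
  rw [airyConst, e]
  ring

theorem continuous_airyIntegrand {η : ℝ} (hη : 0 < η) (k : ℕ) (x : ℝ) :
    Continuous (airyIntegrand η k x) := by
  unfold airyIntegrand airyPhase
  refine Continuous.mul (Continuous.div (by fun_prop) (by fun_prop) fun t => ?_) (by fun_prop)
  exact mul_ne_zero Complex.I_ne_zero (line_ne_zero t hη)

theorem integrable_gaussian_half {η : ℝ} (hη : 0 < η) :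
    Integrable fun t : ℝ => Real.exp (-(η / 2) * t ^ 2) :=
  integrable_exp_neg_mul_sq (half_pos hη)

theorem integrable_airyIntegrand {η : ℝ} (hη : 0 < η) (k : ℕ) (x : ℝ) :
    Integrable (airyIntegrand η k x) :=
  ((integrable_gaussian_half hη).const_mul _).mono'
    (continuous_airyIntegrand hη k x).aestronglyMeasurable
    (ae_of_all _ fun t => norm_airyIntegrand_le hη k x t)

theorem abs_airyContour_le_of_norm_le {η : ℝ} (hη : 0 < η) (k : ℕ) (x : ℝ) {D : ℝ} (hD : 0 ≤ D)
    (h : ∀ t, ‖airyIntegrand η k x t‖ ≤ D * Real.exp (-(η / 2) * t ^ 2)) :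
    |airyContour η k x| ≤ D * √(2 / η) := by
  have h1 : ‖∫ t : ℝ, airyIntegrand η k x t‖ ≤ D * √(2 * Real.pi / η) := by
    refine (norm_integral_le_of_norm_le ((integrable_gaussian_half hη).const_mul D)
      (ae_of_all _ h)).trans_eq ?_
    rw [integral_const_mul, integral_gaussian]
    congr 2
    field_simp
  have h2 := (Complex.abs_re_le_norm _).trans h1
  rw [airyContour, abs_mul, abs_neg, abs_of_pos (by positivity)]
  have hpi := Real.pi_gt_three
  have h3 : √(2 * Real.pi / η) ≤ 2 * Real.pi * √(2 / η) := by
    rw [show 2 * Real.pi / η = Real.pi * (2 / η) by ring, Real.sqrt_mul Real.pi_pos.le]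
    gcongr
    rw [Real.sqrt_le_left (by positivity)]
    nlinarith
  calc (2 * Real.pi)⁻¹ * |(∫ t : ℝ, airyIntegrand η k x t).re|
      ≤ (2 * Real.pi)⁻¹ * (D * (2 * Real.pi * √(2 / η))) := by gcongr; exact h2.trans (by gcongr)
    _ = _ := by field_simp

theorem abs_airyContour_one_le (k : ℕ) (x : ℝ) :
    |airyContour 1 k x| ≤ airyConst 1 k * √2 * Real.exp (-x) := by
  have := abs_airyContour_le_of_norm_le one_pos k x (D := airyConst 1 k * Real.exp (-x))
    (by have := airyConst_pos one_pos k; positivity)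
    (fun t => by simpa using norm_airyIntegrand_le one_pos k x t)
  refine this.trans_eq ?_
  rw [div_one]; ring

/-- On a line high enough that `k ≤ η³`, half of the Gaussian absorbs `(|w| / η)^k`. For
`η³ = k + 1` the right-hand side grows only like `(k!)^(1/3)`, which is where the order `3/2` of the Airy
function enters. The same bound serves the derivatives of order `k` and `k + 1`. -/
theorem abs_airyContour_le {η : ℝ} (hη : 1 ≤ η) {k : ℕ} (hk : (k : ℝ) ≤ η ^ 3) (x : ℝ) {j : ℕ}
    (hj : j = k ∨ j = k + 1) :
    |airyContour η j x| ≤ 2 * η ^ k * Real.exp (η ^ 3 / 3 - x * η) := by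
  have hη0 : 0 < η := by linarith
  have := abs_airyContour_le_of_norm_le hη0 j x
    (D := η ^ k * Real.exp (η ^ 3 / 3 - x * η)) (by positivity) (fun t => by
      rw [norm_airyIntegrand]
      set r := ‖(t : ℂ) + η * Complex.I‖ with hr
      have hrη : η ≤ r := le_norm_line t hη0
      have hr0 : 0 < r := hη0.trans_le hrη
      have h1 : r ^ j / r ≤ r ^ k := by
        rcases hj with rfl | rfl
        · exact div_le_self (by positivity) (hη.trans hrη)
        · rw [pow_succ, mul_div_cancel_right₀ _ hr0.ne']
      have h2 : (r ^ k) ≤ η ^ k * Real.exp (η / 2 * t ^ 2) := by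
        refine (pow_le_pow_iff_left₀ (by positivity) (by positivity) two_ne_zero).1 ?_
        have e1 : (r ^ k) ^ 2 = (η ^ k) ^ 2 * (t ^ 2 / η ^ 2 + 1) ^ k := by
          rw [← pow_mul, mul_comm k 2, pow_mul, hr, norm_line_sq, ← pow_mul η, mul_comm k 2,
            pow_mul η, ← mul_pow]
          congr 1
          field_simp
        -- `(1 + u)^k ≤ exp (k u)` with `u = (t / η)²`, and `k u ≤ η³ u = η t²`.
        have e2 : (t ^ 2 / η ^ 2 + 1) ^ k ≤ Real.exp (η / 2 * t ^ 2) ^ 2 := by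
          calc (t ^ 2 / η ^ 2 + 1) ^ k ≤ Real.exp (t ^ 2 / η ^ 2) ^ k := by
                gcongr; exact Real.add_one_le_exp _
            _ = Real.exp (k * (t ^ 2 / η ^ 2)) := by rw [← Real.exp_nat_mul]
            _ ≤ Real.exp (η ^ 3 * (t ^ 2 / η ^ 2)) := by gcongr
            _ = Real.exp (η / 2 * t ^ 2) ^ 2 := by
                rw [← Real.exp_nat_mul]; congr 1; push_cast; field_simp
        rw [e1, mul_pow]
        gcongr
      calc r ^ j / r * (Real.exp (η ^ 3 / 3 - x * η) * Real.exp (-η * t ^ 2))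
          ≤ (η ^ k * Real.exp (η / 2 * t ^ 2)) *
            (Real.exp (η ^ 3 / 3 - x * η) * Real.exp (-η * t ^ 2)) := by
            gcongr; exact h1.trans h2
        _ = η ^ k * Real.exp (η ^ 3 / 3 - x * η) *
            (Real.exp (η / 2 * t ^ 2) * Real.exp (-η * t ^ 2)) := by ring
        _ = _ := by rw [← Real.exp_add]; congr 2; ring)
  refine this.trans ?_
  have h3 : √(2 / η) ≤ 2 := by
    rw [Real.sqrt_le_left (by norm_num), div_le_iff₀ hη0]
    linarith
  calc _ ≤ η ^ k * Real.exp (η ^ 3 / 3 - x * η) * 2 := by gcongr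
    _ = _ := by ring

theorem hasDerivAt_airyIntegrand (η : ℝ) (k : ℕ) (x t : ℝ) :
    HasDerivAt (fun x => airyIntegrand η k x t) (airyIntegrand η (k + 1) x t) x := by
  unfold airyIntegrand airyPhase
  set w : ℂ := (t : ℂ) + η * Complex.I
  have h1 : HasDerivAt (fun x : ℝ => Complex.I * (w ^ 3 / 3 + x * w)) (Complex.I * w) x := by
    have := (((Complex.ofRealCLM.hasDerivAt (x := x)).mul_const w).const_add (w ^ 3 / 3)).const_mul
      Complex.I
    simpa using this
  refine (h1.cexp.const_mul ((Complex.I * w) ^ k / (Complex.I * w))).congr_deriv ?_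
  have e : (Complex.I * w) ^ (k + 1) / (Complex.I * w)
      = (Complex.I * w) ^ k / (Complex.I * w) * (Complex.I * w) := by
    rw [pow_succ, div_mul_eq_mul_div]
  rw [e]
  ac_rfl

theorem hasDerivAt_airyContour {η : ℝ} (hη : 0 < η) (k : ℕ) (x : ℝ) :
    HasDerivAt (airyContour η k) (airyContour η (k + 1) x) x := by
  have h := (hasDerivAt_integral_of_dominated_loc_of_deriv_le (μ := volume)
    (F := fun x t => airyIntegrand η k x t) (F' := fun x t => airyIntegrand η (k + 1) x t)
    (bound := fun t => airyConst η (k + 1) * Real.exp (-(x - 1) * η) * Real.exp (-(η / 2) * t ^ 2))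
    (Ioo_mem_nhds (sub_one_lt x) (lt_add_one x))
    (Eventually.of_forall fun x => (continuous_airyIntegrand hη k x).aestronglyMeasurable)
    (integrable_airyIntegrand hη k x) (continuous_airyIntegrand hη _ x).aestronglyMeasurable
    (ae_of_all _ fun t y hy => (norm_airyIntegrand_le hη (k + 1) y t).trans (by
      have := airyConst_pos hη (k + 1)
      have := hy.1
      gcongr))
    ((integrable_gaussian_half hη).const_mul _)
    (ae_of_all _ fun t y _ => hasDerivAt_airyIntegrand η k y t)).2
  have h2 := (Complex.reCLM.hasFDerivAt.comp_hasDerivAt x h).const_mul (-(2 * Real.pi)⁻¹)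
  exact h2

/-- Taylor expansion: expand `exp (i h w)` under the integral sign. -/
theorem hasSum_airyContour {η : ℝ} (hη : 0 < η) (j : ℕ) (x h : ℝ) :
    HasSum (fun k : ℕ => airyContour η (j + k) x * h ^ k / k.factorial)
      (airyContour η j (x + h)) := by
  have key : HasSum (fun k : ℕ => ∫ t : ℝ, airyIntegrand η (j + k) x t * (h ^ k / k.factorial : ℂ))
      (∫ t : ℝ, airyIntegrand η j (x + h) t) := by
    have hpt : ∀ t : ℝ, HasSum
        (fun k : ℕ => airyIntegrand η (j + k) x t * (h ^ k / k.factorial : ℂ))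
        (airyIntegrand η j (x + h) t) := by
      intro t
      set w : ℂ := (t : ℂ) + η * Complex.I with hw
      have e := (NormedSpace.expSeries_div_hasSum_exp (Complex.I * w * h)).mul_left
        (airyIntegrand η j x t)
      have e2 : airyIntegrand η j x t * NormedSpace.exp (Complex.I * w * h)
          = airyIntegrand η j (x + h) t := by
        rw [← Complex.exp_eq_exp_ℂ, airyIntegrand, airyIntegrand, airyPhase, airyPhase, mul_assoc,
          ← Complex.exp_add, ← hw]
        congr 2
        push_cast
        ring
      rw [e2] at e
      refine e.congr_fun ?_ |>.congr_fun fun _ => rfl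
      intro k
      rw [airyIntegrand, airyIntegrand, ← hw, pow_add]
      ring_nf
    refine hasSum_integral_of_dominated_convergence
      (fun k t => ‖airyIntegrand η j x t‖ * (|h| * ‖(t : ℂ) + η * Complex.I‖) ^ k / k.factorial)
      (fun k => ((continuous_airyIntegrand hη _ x).mul continuous_const).aestronglyMeasurable)
      (fun k => ae_of_all _ fun t => ?_) (ae_of_all _ fun t => ?_) ?_ (ae_of_all _ hpt)
    · rw [norm_mul, norm_airyIntegrand, norm_airyIntegrand]
      simp only [norm_div, norm_pow, Complex.norm_real, Real.norm_eq_abs, Complex.norm_natCast]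
      rw [pow_add, mul_pow]
      apply le_of_eq
      ring
    · have := (Real.summable_pow_div_factorial (|h| * ‖(t : ℂ) + η * Complex.I‖)).mul_left
        ‖airyIntegrand η j x t‖
      simpa only [mul_div_assoc] using this
    · have hs : ∀ t : ℝ, ∑' k : ℕ,
          ‖airyIntegrand η j x t‖ * (|h| * ‖(t : ℂ) + η * Complex.I‖) ^ k / k.factorial
          = ‖airyIntegrand η j x t‖ * Real.exp (|h| * ‖(t : ℂ) + η * Complex.I‖) := by
        intro t
        simp only [mul_div_assoc]
        rw [tsum_mul_left, Real.exp_eq_exp_ℝ, NormedSpace.exp_eq_tsum_div]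
      simp only [hs]
      refine ((integrable_gaussian_half hη).const_mul (j.factorial / η *
        Real.exp ((|h| + 1) * η + (|h| + 1) ^ 2 / (2 * η)) * Real.exp (η ^ 3 / 3 - x * η))).mono'
        ?_ (ae_of_all _ fun t => ?_)
      · exact ((continuous_airyIntegrand hη _ x).norm.mul (by fun_prop)).aestronglyMeasurable
      · rw [Real.norm_of_nonneg (by positivity)]
        exact norm_airyIntegrand_mul_exp_le hη (abs_nonneg h) j x t
  have h2 := (Complex.reCLM.hasSum key).mul_left (-(2 * Real.pi)⁻¹)
  refine h2.congr_fun ?_ |>.congr_fun fun _ => rfl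
  intro k
  rw [integral_mul_const, airyContour]
  have : ((h : ℂ) ^ k / k.factorial) = ((h ^ k / k.factorial : ℝ) : ℂ) := by push_cast; rfl
  rw [this, Complex.reCLM_apply, Complex.re_mul_ofReal]
  ring

/-! ### The Airy function and its antiderivative -/

theorem airyIntegrand_one {η : ℝ} (hη : 0 < η) (x t : ℝ) :
    airyIntegrand η 1 x t = airyPhase x (t + η * Complex.I) := by
  rw [airyIntegrand, pow_one, div_self (mul_ne_zero Complex.I_ne_zero (line_ne_zero t hη)), one_mul]

theorem airyPhase_ofReal_re (x t : ℝ) :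
    (airyPhase x t).re = Real.cos (t ^ 3 / 3 + x * t) := by
  have : Complex.I * ((t : ℂ) ^ 3 / 3 + x * t) = ((t ^ 3 / 3 + x * t : ℝ) : ℂ) * Complex.I := by
    push_cast; ring
  rw [airyPhase, this, Complex.exp_ofReal_mul_I_re]

theorem continuous_airyPhase (x : ℝ) : Continuous (airyPhase x) := by
  unfold airyPhase; fun_prop

theorem integral_airyPhase_re (x T : ℝ) :
    (∫ t in (-T)..T, airyPhase x t).re
      = 2 * ∫ t in (0 : ℝ)..T, Real.cos (t ^ 3 / 3 + x * t) := by
  have h1 : (∫ t in (-T)..T, airyPhase x t).re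
      = ∫ t in (-T)..T, Real.cos (t ^ 3 / 3 + x * t) := by
    have hc : IntervalIntegrable (fun t : ℝ => airyPhase x t) volume (-T) T :=
      ((continuous_airyPhase x).comp Complex.continuous_ofReal).intervalIntegrable _ _
    have := Complex.reCLM.intervalIntegral_comp_comm hc
    rw [Complex.reCLM_apply] at this
    rw [← this]
    simp only [Complex.reCLM_apply, airyPhase_ofReal_re]
  have hi : ∀ a b : ℝ, IntervalIntegrable (fun t : ℝ => Real.cos (t ^ 3 / 3 + x * t)) volume a b :=
    fun a b => (by fun_prop : Continuous fun t : ℝ =>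
      Real.cos (t ^ 3 / 3 + x * t)).intervalIntegrable _ _
  have h2 : ∫ t in (-T)..0, Real.cos (t ^ 3 / 3 + x * t)
      = ∫ t in (0 : ℝ)..T, Real.cos (t ^ 3 / 3 + x * t) := by
    have := intervalIntegral.integral_comp_neg (a := 0) (b := T)
      (fun t : ℝ => Real.cos (t ^ 3 / 3 + x * t))
    rw [neg_zero] at this
    rw [← this]
    refine intervalIntegral.integral_congr fun t _ => ?_
    rw [← Real.cos_neg]
    congr 1
    ring
  rw [h1, ← intervalIntegral.integral_add_adjacent_intervals (hi _ 0) (hi 0 _), h2, two_mul]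

/-- The vertical sides of the contour do not contribute; the two sides correspond to `l = atTop` and
`l = atBot`. -/
theorem tendsto_vertical_airyPhase {η : ℝ} (hη : 0 < η) (x : ℝ) {l : Filter ℝ}
    [l.IsCountablyGenerated] (hl : Tendsto (fun T : ℝ => T ^ 2) l atTop) :
    Tendsto (fun T : ℝ => ∫ y in (0 : ℝ)..η, airyPhase x (T + y * Complex.I)) l (𝓝 0) := by
  have h := intervalIntegral.tendsto_integral_filter_of_dominated_convergence (μ := volume)
    (l := l) (a := 0) (b := η) (F := fun (T y : ℝ) => airyPhase x (T + y * Complex.I))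
    (f := fun _ => 0) (fun y => Real.exp (y ^ 3 / 3 - x * y))
    (Eventually.of_forall fun T => ((continuous_airyPhase x).comp
      (by fun_prop : Continuous fun y : ℝ => (T : ℂ) + y * Complex.I)).aestronglyMeasurable)
    (Eventually.of_forall fun T => ae_of_all _ fun y hy => ?_)
    ((by fun_prop : Continuous fun y : ℝ =>
      Real.exp (y ^ 3 / 3 - x * y)).intervalIntegrable _ _)
    (ae_of_all _ fun y hy => ?_)
  · simpa using h
  · rw [Set.uIoc_of_le hη.le] at hy
    rw [norm_airyPhase]
    refine mul_le_of_le_one_right (Real.exp_pos _).le (Real.exp_le_one_iff.2 ?_)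
    nlinarith [mul_nonneg hy.1.le (sq_nonneg T)]
  · rw [Set.uIoc_of_le hη.le] at hy
    rw [tendsto_zero_iff_norm_tendsto_zero]
    simp only [norm_airyPhase]
    rw [← mul_zero (Real.exp (y ^ 3 / 3 - x * y))]
    refine Tendsto.const_mul _ (Real.tendsto_exp_atBot.comp ?_)
    exact hl.const_mul_atTop_of_neg (neg_lt_zero.2 hy.1)

/-- Moving the contour to height `η` makes the integral of the Airy function absolutely
convergent. -/
theorem airyAi_eq_neg_airyContour {η : ℝ} (hη : 0 < η) (x : ℝ) :
    airyAi x = -airyContour η 1 x := by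
  have hrect : ∀ T : ℝ, ∫ t in (-T)..T, airyPhase x t
      = (∫ t in (-T)..T, airyPhase x (t + η * Complex.I))
        - Complex.I • (∫ y in (0 : ℝ)..η, airyPhase x (T + y * Complex.I))
        + Complex.I • ∫ y in (0 : ℝ)..η, airyPhase x ((-T : ℝ) + y * Complex.I) := by
    intro T
    have h := Complex.integral_boundary_rect_eq_zero_of_differentiableOn (airyPhase x)
      ((-T : ℝ) : ℂ) (T + η * Complex.I)
      (by unfold airyPhase; fun_prop)
    simp only [Complex.ofReal_re, Complex.add_re, Complex.mul_re, Complex.I_re, mul_zero,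
      Complex.ofReal_im, Complex.I_im, zero_mul, sub_zero, add_zero, Complex.add_im,
      Complex.mul_im, mul_one, zero_add, Complex.ofReal_zero] at h
    linear_combination h
  have hlim : Tendsto (fun T : ℝ => ∫ t in (-T)..T, airyPhase x t) atTop
      (𝓝 (∫ t : ℝ, airyPhase x (t + η * Complex.I))) := by
    have hint : Integrable fun t : ℝ => airyPhase x (t + η * Complex.I) :=
      (integrable_airyIntegrand hη 1 x).congr (ae_of_all _ fun t => airyIntegrand_one hη x t)
    have h1 := intervalIntegral_tendsto_integral hint tendsto_neg_atTop_atBot tendsto_id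
    have h2 := tendsto_vertical_airyPhase hη x (l := atTop) (tendsto_pow_atTop two_ne_zero)
    have h3 : Tendsto (fun T : ℝ => ∫ y in (0 : ℝ)..η, airyPhase x ((-T : ℝ) + y * Complex.I))
        atTop (𝓝 0) := by
      refine (tendsto_vertical_airyPhase hη x (l := atBot) ?_).comp tendsto_neg_atTop_atBot
      have := (tendsto_pow_atTop (α := ℝ) two_ne_zero).comp tendsto_neg_atBot_atTop
      simpa [Function.comp_def] using this
    have := (h1.sub (h2.const_smul Complex.I)).add (h3.const_smul Complex.I)
    simp only [smul_zero, sub_zero, add_zero] at this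
    exact this.congr fun T => (hrect T).symm
  have hre := (Complex.continuous_re.tendsto _).comp hlim
  have hcos : Tendsto (fun T : ℝ => ∫ t in (0 : ℝ)..T, Real.cos (t ^ 3 / 3 + x * t)) atTop
      (𝓝 (2⁻¹ * (∫ t : ℝ, airyPhase x (t + η * Complex.I)).re)) := by
    refine (hre.const_mul 2⁻¹).congr fun T => ?_
    rw [Function.comp_apply, integral_airyPhase_re]
    ring
  rw [airyAi, hcos.limUnder_eq, airyContour]
  simp only [airyIntegrand_one hη]
  rw [mul_inv]
  ring

/-- The Airy equation `Ai'' = x Ai`: the derivative of `airyPhase` has vanishing integral. -/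
theorem airyContour_three (x : ℝ) : airyContour 1 3 x = x * airyContour 1 1 x := by
  have hd : ∀ t : ℝ, HasDerivAt (fun t : ℝ => airyIntegrand 1 1 x t)
      (-Complex.I * (airyIntegrand 1 3 x t - x * airyIntegrand 1 1 x t)) t := by
    intro t
    simp only [airyIntegrand_one one_pos]
    have hw := line_ne_zero t one_pos
    rw [airyIntegrand]
    have hid : HasDerivAt (fun t : ℝ => (t : ℂ) + (1 : ℝ) * Complex.I) 1 t :=
      (Complex.ofRealCLM.hasDerivAt (x := t)).add_const _
    unfold airyPhase
    set w : ℂ := (t : ℂ) + (1 : ℝ) * Complex.I with hwdef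
    have h1 := (((hid.pow 3).div_const 3).add (hid.const_mul (x : ℂ))).const_mul Complex.I
    refine h1.cexp.congr_deriv ?_
    simp only [Pi.add_apply, Pi.pow_apply, ← hwdef]
    have e : (Complex.I * w) ^ 3 / (Complex.I * w) = -w ^ 2 := by
      have : Complex.I * w ≠ 0 := mul_ne_zero Complex.I_ne_zero hw
      rw [div_eq_iff this]
      linear_combination (Complex.I * w ^ 3) * Complex.I_sq
    rw [e]
    ring
  have hi := integrable_airyIntegrand one_pos
  have h0 := integral_eq_zero_of_hasDerivAt_of_integrable hd
    (((hi 3 x).sub ((hi 1 x).const_mul _)).const_mul _) (hi 1 x)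
  rw [integral_const_mul, integral_sub (hi 3 x) ((hi 1 x).const_mul _), integral_const_mul,
    mul_eq_zero, or_iff_right (neg_ne_zero.2 Complex.I_ne_zero), sub_eq_zero] at h0
  rw [airyContour, airyContour, h0, Complex.re_ofReal_mul]
  ring

/-- The `k`-th derivative of `x ↦ ∫_x^∞ Ai`; in particular it is `-Ai` for `k = 1`. -/
noncomputable def airyTailDeriv (k : ℕ) (x : ℝ) : ℝ := airyContour 1 k x

theorem hasDerivAt_airyTailDeriv (k : ℕ) (x : ℝ) :
    HasDerivAt (airyTailDeriv k) (airyTailDeriv (k + 1) x) x :=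
  hasDerivAt_airyContour one_pos k x

theorem continuous_airyTailDeriv (k : ℕ) : Continuous (airyTailDeriv k) :=
  continuous_iff_continuousAt.2 fun x => (hasDerivAt_airyTailDeriv k x).continuousAt

theorem airyAi_eq (x : ℝ) : airyAi x = -airyTailDeriv 1 x :=
  airyAi_eq_neg_airyContour one_pos x

theorem deriv_airyAi (x : ℝ) : deriv airyAi x = -airyTailDeriv 2 x := by
  rw [show airyAi = fun x => -airyTailDeriv 1 x from funext airyAi_eq]
  exact (hasDerivAt_airyTailDeriv 1 x).neg.deriv

theorem airyTailDeriv_three (x : ℝ) : airyTailDeriv 3 x = x * airyTailDeriv 1 x :=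
  airyContour_three x

theorem exists_abs_airyTailDeriv_le (k : ℕ) :
    ∃ D : ℝ, 0 < D ∧ ∀ x, |airyTailDeriv k x| ≤ D * Real.exp (-x) :=
  ⟨airyConst 1 k * √2, mul_pos (airyConst_pos one_pos k) (by positivity),
    abs_airyContour_one_le k⟩

theorem tendsto_airyContour_zero {η : ℝ} (hη : 0 < η) (k : ℕ) :
    Tendsto (airyContour η k) atTop (𝓝 0) := by
  refine squeeze_zero_norm (a := fun x => airyConst η k * Real.exp (-x * η) * √(2 / η))
    (fun x => ?_) ?_
  · have := airyConst_pos hη k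
    exact abs_airyContour_le_of_norm_le hη k x (by positivity) (norm_airyIntegrand_le hη k x)
  · rw [← zero_mul √(2 / η), ← mul_zero (airyConst η k)]
    refine (Tendsto.const_mul _ (Real.tendsto_exp_atBot.comp ?_)).mul_const _
    exact tendsto_neg_atTop_atBot.atBot_mul_const hη

theorem integrableOn_airyAi (x : ℝ) : IntegrableOn airyAi (Set.Ioi x) := by
  obtain ⟨D, hD, h⟩ := exists_abs_airyTailDeriv_le 1
  have hc : Continuous airyAi := by
    rw [show airyAi = fun x => -airyTailDeriv 1 x from funext airyAi_eq]
    exact (continuous_airyTailDeriv 1).neg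
  refine ((integrableOn_exp_neg_Ioi x).const_mul D).mono' hc.aestronglyMeasurable
    (ae_of_all _ fun u => ?_)
  rw [airyAi_eq, norm_neg]
  exact h u

theorem airyTail_eq_airyContour {η : ℝ} (hη : 0 < η) (x : ℝ) :
    airyTail x = airyContour η 0 x := by
  have h := integral_Ioi_of_hasDerivAt_of_tendsto' (f := fun u => -airyContour η 0 u)
    (f' := airyAi) (a := x) (m := 0)
    (fun u _ => by
      rw [airyAi_eq_neg_airyContour hη]
      exact (hasDerivAt_airyContour hη 0 u).neg)
    (integrableOn_airyAi x) (by simpa using (tendsto_airyContour_zero hη 0).neg)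
  rw [airyTail, h]
  ring

theorem airyTail_eq (x : ℝ) : airyTail x = airyTailDeriv 0 x :=
  airyTail_eq_airyContour one_pos x

/-- The height of the contour may be chosen for each `k` separately. For `k = 0` every height gives
`∫_x^∞ Ai`, and the derivatives follow. -/
theorem airyTailDeriv_eq_airyContour {η : ℝ} (hη : 0 < η) (k : ℕ) :
    airyTailDeriv k = airyContour η k := by
  induction k with
  | zero =>
    funext x
    rw [← airyTail_eq, airyTail_eq_airyContour hη]
  | succ k ih =>
    funext x
    have h := hasDerivAt_airyTailDeriv k x
    rw [ih] at h
    exact h.unique (hasDerivAt_airyContour hη k x)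

/-! ### The symplectic Airy kernel as a pairing -/

/-- `∫_0^∞ T⁽ʲ⁾(x + z) T⁽ᵏ⁾(y + z) dz` for `T(x) = ∫_x^∞ Ai`. -/
noncomputable def airyPairing (j k : ℕ) (x y : ℝ) : ℝ :=
  ∫ z in Set.Ioi (0 : ℝ), airyTailDeriv j (x + z) * airyTailDeriv k (y + z)

theorem airyPairing_comm (j k : ℕ) (x y : ℝ) : airyPairing j k x y = airyPairing k j y x := by
  simp only [airyPairing, mul_comm]

theorem abs_mul_airyTailDeriv_le {j k : ℕ} {D E : ℝ}
    (hD : ∀ x, |airyTailDeriv j x| ≤ D * Real.exp (-x))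
    (hE : ∀ x, |airyTailDeriv k x| ≤ E * Real.exp (-x)) (x y : ℝ) {z : ℝ} (hz : 0 ≤ z) :
    |airyTailDeriv j (x + z) * airyTailDeriv k (y + z)|
      ≤ D * E * Real.exp (-x) * Real.exp (-y) * Real.exp (-z) := by
  rw [abs_mul]
  calc |airyTailDeriv j (x + z)| * |airyTailDeriv k (y + z)|
      ≤ (D * Real.exp (-(x + z))) * (E * Real.exp (-(y + z))) :=
        mul_le_mul (hD _) (hE _) (abs_nonneg _) ((abs_nonneg _).trans (hD _))
    _ = D * E * Real.exp (-x) * Real.exp (-y) * (Real.exp (-z) * Real.exp (-z)) := by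
        rw [neg_add, neg_add, Real.exp_add, Real.exp_add]; ring
    _ ≤ D * E * Real.exp (-x) * Real.exp (-y) * Real.exp (-z) := by
        have hD0 : 0 ≤ D := by
          have := (abs_nonneg _).trans (hD 0); simpa using this
        have hE0 : 0 ≤ E := by
          have := (abs_nonneg _).trans (hE 0); simpa using this
        gcongr
        exact mul_le_of_le_one_left (Real.exp_pos _).le (Real.exp_le_one_iff.2 (by linarith))

theorem continuous_mul_airyTailDeriv (j k : ℕ) (x y : ℝ) :
    Continuous fun z => airyTailDeriv j (x + z) * airyTailDeriv k (y + z) :=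
  ((continuous_airyTailDeriv j).comp (continuous_const_add x)).mul
    ((continuous_airyTailDeriv k).comp (continuous_const_add y))

theorem integrableOn_mul_airyTailDeriv (j k : ℕ) (x y : ℝ) :
    IntegrableOn (fun z => airyTailDeriv j (x + z) * airyTailDeriv k (y + z)) (Set.Ioi 0) := by
  obtain ⟨D, hD0, hD⟩ := exists_abs_airyTailDeriv_le j
  obtain ⟨E, hE0, hE⟩ := exists_abs_airyTailDeriv_le k
  refine ((integrableOn_exp_neg_Ioi 0).const_mul
    (D * E * Real.exp (-x) * Real.exp (-y))).mono'
    (continuous_mul_airyTailDeriv j k x y).aestronglyMeasurable ?_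
  filter_upwards [ae_restrict_mem measurableSet_Ioi] with z hz
  exact abs_mul_airyTailDeriv_le hD hE x y (le_of_lt hz)

theorem exists_abs_airyPairing_le (j k : ℕ) (y : ℝ) :
    ∃ D : ℝ, ∀ x, |airyPairing j k x y| ≤ D * Real.exp (-x) := by
  obtain ⟨D, hD0, hD⟩ := exists_abs_airyTailDeriv_le j
  obtain ⟨E, hE0, hE⟩ := exists_abs_airyTailDeriv_le k
  refine ⟨D * E * Real.exp (-y), fun x => ?_⟩
  have := norm_integral_le_of_norm_le ((integrableOn_exp_neg_Ioi 0).const_mul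
    (D * E * Real.exp (-x) * Real.exp (-y)))
    (f := fun z => airyTailDeriv j (x + z) * airyTailDeriv k (y + z)) (by
      filter_upwards [ae_restrict_mem measurableSet_Ioi] with z hz
      exact abs_mul_airyTailDeriv_le hD hE x y (le_of_lt hz))
  rw [integral_const_mul, integral_exp_neg_Ioi_zero, mul_one] at this
  refine (show |airyPairing j k x y| ≤ _ from this).trans_eq (by ring)

theorem hasDerivAt_airyPairing (j k : ℕ) (x y : ℝ) :
    HasDerivAt (fun x => airyPairing j k x y) (airyPairing (j + 1) k x y) x := by
  obtain ⟨D, hD0, hD⟩ := exists_abs_airyTailDeriv_le (j + 1)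
  obtain ⟨E, hE0, hE⟩ := exists_abs_airyTailDeriv_le k
  refine (hasDerivAt_integral_of_dominated_loc_of_deriv_le
    (μ := volume.restrict (Set.Ioi (0 : ℝ)))
    (F := fun x z => airyTailDeriv j (x + z) * airyTailDeriv k (y + z))
    (F' := fun x z => airyTailDeriv (j + 1) (x + z) * airyTailDeriv k (y + z))
    (bound := fun z => D * E * Real.exp (-(x - 1)) * Real.exp (-y) * Real.exp (-z))
    (Ioo_mem_nhds (sub_one_lt x) (lt_add_one x))
    (Eventually.of_forall fun x => (continuous_mul_airyTailDeriv j k x y).aestronglyMeasurable)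
    (integrableOn_mul_airyTailDeriv j k x y)
    (continuous_mul_airyTailDeriv (j + 1) k x y).aestronglyMeasurable ?_
    ((integrableOn_exp_neg_Ioi 0).const_mul _) ?_).2
  · filter_upwards [ae_restrict_mem measurableSet_Ioi] with z hz u hu
    refine (abs_mul_airyTailDeriv_le hD hE u y (le_of_lt hz)).trans ?_
    have := hu.1
    gcongr
  · refine ae_of_all _ fun z u _ => ?_
    exact ((hasDerivAt_airyTailDeriv j (u + z)).comp_add_const u z).mul_const _

theorem tendsto_airyTailDeriv_add (k : ℕ) (x : ℝ) :
    Tendsto (fun z => airyTailDeriv k (x + z)) atTop (𝓝 0) :=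
  (tendsto_airyContour_zero one_pos k).comp (tendsto_atTop_add_const_left _ x tendsto_id)

theorem tendsto_add_mul_airyTailDeriv (k : ℕ) (x : ℝ) :
    Tendsto (fun z => (x + z) * airyTailDeriv k (x + z)) atTop (𝓝 0) := by
  obtain ⟨D, hD0, hD⟩ := exists_abs_airyTailDeriv_le k
  suffices h : Tendsto (fun u => u * airyTailDeriv k u) atTop (𝓝 0) from
    h.comp (tendsto_atTop_add_const_left _ x tendsto_id)
  refine squeeze_zero_norm' (a := fun u => D * (u ^ 1 * Real.exp (-u))) ?_ ?_
  · filter_upwards [eventually_ge_atTop 0] with u hu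
    rw [norm_mul, Real.norm_of_nonneg hu, pow_one]
    calc u * ‖airyTailDeriv k u‖ ≤ u * (D * Real.exp (-u)) := by gcongr; exact hD u
      _ = _ := by ring
  · rw [← mul_zero D]
    exact (Real.tendsto_pow_mul_exp_neg_atTop_nhds_zero 1).const_mul D

/-- Integration by parts. -/
theorem airyPairing_zero_two (x y : ℝ) :
    airyPairing 0 2 x y = -airyPairing 1 1 x y - airyTailDeriv 0 x * airyTailDeriv 1 y := by
  have h := integral_Ioi_of_hasDerivAt_of_tendsto' (a := (0 : ℝ)) (m := 0)
    (f := fun z => airyTailDeriv 0 (x + z) * airyTailDeriv 1 (y + z))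
    (f' := fun z => airyTailDeriv 1 (x + z) * airyTailDeriv 1 (y + z)
      + airyTailDeriv 0 (x + z) * airyTailDeriv 2 (y + z))
    (fun z _ => ((hasDerivAt_airyTailDeriv 0 (x + z)).comp_const_add x z).mul
      ((hasDerivAt_airyTailDeriv 1 (y + z)).comp_const_add y z))
    ((integrableOn_mul_airyTailDeriv 1 1 x y).add (integrableOn_mul_airyTailDeriv 0 2 x y))
    (by simpa using (tendsto_airyTailDeriv_add 0 x).mul (tendsto_airyTailDeriv_add 1 y))
  rw [integral_add (integrableOn_mul_airyTailDeriv 1 1 x y)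
    (integrableOn_mul_airyTailDeriv 0 2 x y)] at h
  simp only [add_zero] at h
  simp only [airyPairing]
  linarith

/-- The Airy kernel is `∫_0^∞ Ai(x + z) Ai(y + z) dz`: by the Airy equation, moving both arguments
of the kernel by `z` has derivative `-Ai(x + z) Ai(y + z)`. -/
theorem airyKernel_eq_airyPairing (x y : ℝ) : airyKernel x y = airyPairing 1 1 x y := by
  have d1 := fun x z => (hasDerivAt_airyTailDeriv 1 (x + z)).comp_const_add x z
  have d2 := fun x z => (hasDerivAt_airyTailDeriv 2 (x + z)).comp_const_add x z
  have ode := airyTailDeriv_three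
  simp only [Nat.reduceAdd] at d1 d2
  simp only [ode] at d2
  have hint := (integrableOn_mul_airyTailDeriv 1 1 x y).neg
  have hlim := tendsto_airyTailDeriv_add
  rw [airyKernel]
  split_ifs with hxy
  · subst hxy
    have h := integral_Ioi_of_hasDerivAt_of_tendsto' (a := (0 : ℝ)) (m := 0)
      (f := fun z => airyTailDeriv 2 (x + z) * airyTailDeriv 2 (x + z)
        - (x + z) * airyTailDeriv 1 (x + z) * airyTailDeriv 1 (x + z))
      (f' := fun z => -(airyTailDeriv 1 (x + z) * airyTailDeriv 1 (x + z)))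
      (fun z _ => by
        refine (((d2 x z).mul (d2 x z)).sub ((((hasDerivAt_id z).const_add x).mul
          (d1 x z)).mul (d1 x z))).congr_deriv ?_
        simp only [id, Pi.mul_apply]
        ring)
      hint (by
        simpa using ((hlim 2 x).mul (hlim 2 x)).sub
          ((tendsto_add_mul_airyTailDeriv 1 x).mul (hlim 1 x)))
    rw [integral_neg] at h
    simp only [add_zero] at h
    rw [airyPairing, deriv_airyAi, airyAi_eq]
    linear_combination h
  · have hne : x - y ≠ 0 := sub_ne_zero.2 hxy
    have h := integral_Ioi_of_hasDerivAt_of_tendsto' (a := (0 : ℝ)) (m := 0)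
      (f := fun z => (airyTailDeriv 1 (x + z) * airyTailDeriv 2 (y + z)
        - airyTailDeriv 1 (y + z) * airyTailDeriv 2 (x + z)) / (x - y))
      (f' := fun z => -(airyTailDeriv 1 (x + z) * airyTailDeriv 1 (y + z)))
      (fun z _ => by
        refine ((((d1 x z).mul (d2 y z)).sub ((d1 y z).mul (d2 x z))).div_const
          (x - y)).congr_deriv ?_
        field_simp
        ring)
      hint (by
        simpa using (((hlim 1 x).mul (hlim 2 y)).sub ((hlim 1 y).mul (hlim 2 x))).div_const (x - y))
    rw [integral_neg] at h
    simp only [add_zero] at h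
    rw [airyPairing, deriv_airyAi, deriv_airyAi, airyAi_eq, airyAi_eq]
    linear_combination h

theorem integral_airyKernel (x y : ℝ) :
    ∫ u in Set.Ioi x, airyKernel u y = -airyPairing 0 1 x y := by
  have hc : Continuous fun u => airyPairing 1 1 u y :=
    continuous_iff_continuousAt.2 fun u => (hasDerivAt_airyPairing 1 1 u y).continuousAt
  obtain ⟨D, hD⟩ := exists_abs_airyPairing_le 1 1 y
  obtain ⟨E, hE⟩ := exists_abs_airyPairing_le 0 1 y
  have hlim : Tendsto (fun u => airyPairing 0 1 u y) atTop (𝓝 0) := by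
    refine squeeze_zero_norm hE ?_
    rw [← mul_zero E]
    exact (Real.tendsto_exp_atBot.comp tendsto_neg_atTop_atBot).const_mul E
  have h := integral_Ioi_of_hasDerivAt_of_tendsto' (a := x)
    (fun u _ => hasDerivAt_airyPairing 0 1 u y)
    (((integrableOn_exp_neg_Ioi x).const_mul D).mono' hc.aestronglyMeasurable
      (ae_of_all _ hD)) hlim
  simp only [airyKernel_eq_airyPairing]
  rw [zero_sub] at h
  exact h

/-- In terms of `T(x) = ∫_x^∞ Ai` and `τ₀ = T`, `τ₁ = Ai = -T'`, all four entries of the kernel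
have the form `½ ∫_0^∞ τ_a(x + z) τ_b'(y + z) dz + ¼ τ_a(x) τ_b(y)`. -/
theorem symplecticAiryKernel_eq (x y : ℝ) (a b : Fin 2) :
    symplecticAiryKernel x y a b = (-1) ^ (a : ℕ) * (-1) ^ (b : ℕ) *
      (1 / 2 * airyPairing a (b + 1) x y + 1 / 4 * airyTailDeriv a x * airyTailDeriv b y) := by
  have h22 : deriv (fun v => airyKernel x v) y = airyPairing 1 2 x y := by
    simp only [airyKernel_eq_airyPairing]
    simp only [airyPairing_comm _ _ x]
    exact (hasDerivAt_airyPairing 1 1 y x).deriv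
  fin_cases a <;> fin_cases b
  · simp only [symplecticAiryKernel, symplecticAiry₁₁, integral_airyKernel, airyTail_eq]
    simp
  · simp only [symplecticAiryKernel, symplecticAiry₁₂, airyKernel_eq_airyPairing, airyTail_eq,
      airyAi_eq]
    simp [airyPairing_zero_two]
    ring
  · simp only [symplecticAiryKernel, symplecticAiry₁₂, airyKernel_eq_airyPairing, airyTail_eq,
      airyAi_eq]
    simp [airyPairing_comm 1 1 y x]
  · simp only [symplecticAiryKernel, symplecticAiry₂₂, h22, airyAi_eq]
    simp

/-! ### Pfaffians of congruences -/

/-- Cauchy–Binet for the Pfaffian, for a congruence `V C Vᵀ` with a rectangular matrix `V`; the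
matrix `C` need not be antisymmetric. -/
theorem pfaffian_congruence {n : ℕ} {κ : Type*} [Fintype κ]
    (V : Fin n × Fin 2 → κ → ℝ) (C : κ → κ → ℝ) :
    pfaffian (Matrix.of fun p q => ∑ k, ∑ l, V p k * C k l * V q l)
      = (2 ^ n * (n.factorial : ℝ))⁻¹ * ∑ g : Fin n × Fin 2 → κ,
          (Matrix.of fun p q => V p (g q)).det * ∏ i, C (g (i, 0)) (g (i, 1)) := by
  classical
  rw [pfaffian]
  congr 1
  simp only [Matrix.det_apply', Finset.sum_mul, Matrix.of_apply]
  rw [Finset.sum_comm]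
  refine Finset.sum_congr rfl fun σ _ => ?_
  simp only [mul_assoc]
  rw [← Finset.mul_sum]
  congr 1
  have e : ∀ i : Fin n, ∑ k, ∑ l, V (σ (i, 0)) k * (C k l * V (σ (i, 1)) l)
      = ∑ f : Fin 2 → κ, V (σ (i, 0)) (f 0) * (C (f 0) (f 1) * V (σ (i, 1)) (f 1)) := by
    intro i
    rw [← Fintype.sum_prod_type' (f := fun k l => V (σ (i, 0)) k * (C k l * V (σ (i, 1)) l))]
    exact (Equiv.sum_comp (piFinTwoEquiv fun _ => κ)
      (fun p : κ × κ => V (σ (i, 0)) p.1 * (C p.1 p.2 * V (σ (i, 1)) p.2))).symm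
  simp only [e]
  rw [Finset.prod_univ_sum, Fintype.piFinset_univ,
    ← Equiv.sum_comp (Equiv.curry (Fin n) (Fin 2) κ)]
  refine Finset.sum_congr rfl fun g _ => ?_
  rw [Fintype.prod_prod_type, ← Finset.prod_mul_distrib]
  refine Finset.prod_congr rfl fun i _ => ?_
  simp only [Equiv.curry_apply, Function.curry, Fin.prod_univ_two]
  ring

theorem abs_det_le_factorial_mul_prod {ι : Type*} [Fintype ι] [DecidableEq ι] (M : Matrix ι ι ℝ)
    (v : ι → ℝ) (h : ∀ p q, |M p q| ≤ v q) :
    |M.det| ≤ (Fintype.card ι).factorial * ∏ q, v q := by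
  rw [Matrix.det_apply']
  calc |∑ σ : Equiv.Perm ι, ((Equiv.Perm.sign σ : ℤ) : ℝ) * ∏ q, M (σ q) q|
      ≤ ∑ σ : Equiv.Perm ι, |((Equiv.Perm.sign σ : ℤ) : ℝ) * ∏ q, M (σ q) q| :=
        Finset.abs_sum_le_sum_abs _ _
    _ ≤ ∑ _σ : Equiv.Perm ι, ∏ q, v q := by
        refine Finset.sum_le_sum fun σ _ => ?_
        have hs : |((Equiv.Perm.sign σ : ℤ) : ℝ)| = 1 := by
          rcases Int.units_eq_one_or (Equiv.Perm.sign σ) with h | h <;> simp [h]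
        rw [abs_mul, hs, one_mul, Finset.abs_prod]
        exact Finset.prod_le_prod (fun _ _ => abs_nonneg _) fun q _ => h _ _
    _ = _ := by simp [Fintype.card_perm]

/-- Over a set of `m` natural numbers, the product of a quasi-decreasing sequence is largest, up to
a factor `S ^ m`, when the set is `{0, …, m - 1}`. -/
theorem prod_le_pow_mul_prod_range {q : ℕ → ℝ} {S : ℝ} (hS : 0 ≤ S) (hq : ∀ k, 0 ≤ q k)
    (h : ∀ k j, q (k + j) ≤ S * q k) (s : Finset ℕ) :
    ∏ k ∈ s, q k ≤ S ^ s.card * ∏ i ∈ Finset.range s.card, q i := by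
  induction s using Finset.induction_on_max with
  | empty => simp
  | insert x s hx ih =>
    have hxs : x ∉ s := fun hmem => (hx x hmem).false
    have hc : s.card ≤ x := by
      simpa using Finset.card_le_card
        (fun y hy => Finset.mem_range.2 (hx y hy) : s ⊆ Finset.range x)
    have h1 : q x ≤ S * q s.card := by
      have := h s.card (x - s.card)
      rwa [Nat.add_sub_cancel' hc] at this
    rw [Finset.prod_insert hxs, Finset.card_insert_of_notMem hxs, Finset.prod_range_succ, pow_succ]
    calc q x * ∏ k ∈ s, q k
        ≤ (S * q s.card) * (S ^ s.card * ∏ i ∈ Finset.range s.card, q i) :=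
          mul_le_mul h1 ih (Finset.prod_nonneg fun _ _ => hq _) (mul_nonneg hS (hq _))
      _ = _ := by ring

theorem prod_injective_le {ι : Type*} [Fintype ι] {q : ℕ → ℝ} {S : ℝ} (hS : 0 ≤ S)
    (hq : ∀ k, 0 ≤ q k) (h : ∀ k j, q (k + j) ≤ S * q k) {g : ι → ℕ}
    (hg : Function.Injective g) :
    ∏ i, q (g i) ≤ S ^ Fintype.card ι * ∏ i ∈ Finset.range (Fintype.card ι), q i := by
  classical
  have := prod_le_pow_mul_prod_range hS hq h (Finset.univ.image g)
  rwa [Finset.prod_image (fun _ _ _ _ e => hg e), Finset.card_image_of_injective _ hg,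
    Finset.card_univ] at this

/-- Only the injective selections `g` contribute to `pfaffian_congruence`, so that a rapid decay of
the coefficients makes the Pfaffian as small as the product of the first `2n` weights. -/
theorem abs_pfaffian_congruence_le {n N : ℕ} (V : Fin n × Fin 2 → ℕ → ℝ) (C : ℕ → ℕ → ℝ)
    {v c q : ℕ → ℝ} {A S : ℝ} (hA : 0 ≤ A) (hS : 0 ≤ S) (hq : ∀ k, 0 ≤ q k)
    (hqS : ∀ k j, q (k + j) ≤ S * q k) (hV : ∀ p k, |V p k| ≤ v k)
    (hC : ∀ k l, |C k l| ≤ c k * c l) (hc : ∀ k, 0 ≤ c k)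
    (hvc : ∀ k, v k * c k ≤ A * (1 / 2) ^ k * q k) :
    |pfaffian (Matrix.of fun p q : Fin n × Fin 2 =>
        ∑ k ∈ Finset.range N, ∑ l ∈ Finset.range N, V p k * C k l * V q l)|
      ≤ (2 * n).factorial * (2 * A * S) ^ (2 * n) * ∏ i ∈ Finset.range (2 * n), q i := by
  classical
  have hcard : Fintype.card (Fin n × Fin 2) = 2 * n := by simp [mul_comm]
  rcases Nat.eq_zero_or_pos n with rfl | hn
  · simp [pfaffian]
  have hv : ∀ k, 0 ≤ v k := fun k => (abs_nonneg _).trans (hV (⟨0, hn⟩, 0) k)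
  simp only [Finset.sum_range]
  rw [pfaffian_congruence (fun p (k : Fin N) => V p k) (fun k l : Fin N => C k l)]
  rw [abs_mul, abs_of_pos (by positivity)]
  have hle1 : (2 ^ n * (n.factorial : ℝ))⁻¹ ≤ 1 := by
    refine inv_le_one_of_one_le₀ (one_le_mul_of_one_le_of_one_le (one_le_pow₀ one_le_two) ?_)
    exact_mod_cast Nat.one_le_iff_ne_zero.2 n.factorial_ne_zero
  refine (mul_le_of_le_one_left (abs_nonneg _) hle1).trans ?_
  set Q := ∏ i ∈ Finset.range (2 * n), q i with hQ
  have hQ0 : 0 ≤ Q := Finset.prod_nonneg fun _ _ => hq _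
  have hterm : ∀ g : Fin n × Fin 2 → Fin N,
      |(Matrix.of fun p r => V p (g r)).det * ∏ i, C (g (i, 0)) (g (i, 1))|
        ≤ (2 * n).factorial * (A * S) ^ (2 * n) * Q * ∏ r, (1 / 2 : ℝ) ^ (g r : ℕ) := by
    intro g
    by_cases hg : Function.Injective g
    · have h1 := abs_det_le_factorial_mul_prod (Matrix.of fun p r => V p (g r))
        (fun r => v (g r)) (fun p r => hV p _)
      have h2 : |∏ i, C (g (i, 0)) (g (i, 1))| ≤ ∏ r, c (g r) := by
        rw [Finset.abs_prod, Fintype.prod_prod_type]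
        refine Finset.prod_le_prod (fun _ _ => abs_nonneg _) fun i _ => ?_
        rw [Fin.prod_univ_two]
        exact hC _ _
      have h3 := prod_injective_le hS hq hqS (g := fun r => (g r : ℕ))
        (Fin.val_injective.comp hg)
      rw [hcard] at h1 h3
      rw [abs_mul]
      calc _ ≤ ((2 * n).factorial * ∏ r, v (g r)) * ∏ r, c (g r) :=
            mul_le_mul h1 h2 (abs_nonneg _)
              (mul_nonneg (by positivity) (Finset.prod_nonneg fun _ _ => hv _))
        _ = (2 * n).factorial * ∏ r, v (g r) * c (g r) := by
            rw [Finset.prod_mul_distrib]; ring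
        _ ≤ (2 * n).factorial * ∏ r, A * (1 / 2 : ℝ) ^ (g r : ℕ) * q (g r) := by
            refine mul_le_mul_of_nonneg_left (Finset.prod_le_prod
              (fun r _ => mul_nonneg (hv _) (hc _)) fun r _ => hvc _) (by positivity)
        _ = (2 * n).factorial * A ^ (2 * n) * (∏ r, (1 / 2 : ℝ) ^ (g r : ℕ)) *
              ∏ r, q (g r) := by
            rw [Finset.prod_mul_distrib, Finset.prod_mul_distrib, Finset.prod_const,
              Finset.card_univ, hcard]
            ring
        _ ≤ (2 * n).factorial * A ^ (2 * n) * (∏ r, (1 / 2 : ℝ) ^ (g r : ℕ)) *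
              (S ^ (2 * n) * Q) := by gcongr
        _ = _ := by rw [mul_pow]; ring
    · obtain ⟨r, r', hrr, hne⟩ := Function.not_injective_iff.1 hg
      rw [Matrix.det_zero_of_column_eq hne (fun p => by simp [hrr]), zero_mul, abs_zero]
      positivity
  have hgeom : ∑ g : Fin n × Fin 2 → Fin N, ∏ r, (1 / 2 : ℝ) ^ (g r : ℕ) ≤ 2 ^ (2 * n) := by
    have h1 := Finset.prod_univ_sum (fun _ : Fin n × Fin 2 => (Finset.univ : Finset (Fin N)))
      (fun _ k => (1 / 2 : ℝ) ^ (k : ℕ))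
    rw [Fintype.piFinset_univ] at h1
    rw [← h1, Finset.prod_const, Finset.card_univ, hcard]
    have h2 : ∑ k : Fin N, (1 / 2 : ℝ) ^ (k : ℕ) ≤ 2 := by
      rw [Fin.sum_univ_eq_sum_range (fun k => (1 / 2 : ℝ) ^ k)]
      exact sum_geometric_two_le N
    gcongr
  calc _ ≤ ∑ g : Fin n × Fin 2 → Fin N,
        |(Matrix.of fun p r => V p (g r)).det * ∏ i, C (g (i, 0)) (g (i, 1))| :=
        Finset.abs_sum_le_sum_abs _ _
    _ ≤ ∑ g : Fin n × Fin 2 → Fin N,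
        (2 * n).factorial * (A * S) ^ (2 * n) * Q * ∏ r, (1 / 2 : ℝ) ^ (g r : ℕ) :=
        Finset.sum_le_sum fun g _ => hterm g
    _ ≤ (2 * n).factorial * (A * S) ^ (2 * n) * Q * 2 ^ (2 * n) := by
        rw [← Finset.mul_sum]
        gcongr
    _ = _ := by rw [mul_assoc 2 A S, mul_pow 2 (A * S)]; ring

theorem continuous_pfaffian {n : ℕ} :
    Continuous (pfaffian : Matrix (Fin n × Fin 2) (Fin n × Fin 2) ℝ → ℝ) := by
  unfold pfaffian
  refine continuous_const.mul (continuous_finsetSum _ fun σ _ => continuous_const.mul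
    (continuous_finsetProd _ fun i _ => ?_))
  exact continuous_id.matrix_elem _ _

/-! ### Taylor expansion of the kernel -/

/-- The weights `(B / (k + 1))^k`, of the order of `B^k / k!`. -/
noncomputable def factorialWeight (B : ℝ) (k : ℕ) : ℝ := (B / (k + 1)) ^ k

theorem factorialWeight_nonneg {B : ℝ} (hB : 0 ≤ B) (k : ℕ) : 0 ≤ factorialWeight B k := by
  unfold factorialWeight; positivity

theorem factorial_le_succ_pow (k : ℕ) : (k.factorial : ℝ) ≤ ((k : ℝ) + 1) ^ k := by
  exact_mod_cast k.factorial_le_pow.trans (Nat.pow_le_pow_left k.le_succ k)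

theorem factorialWeight_le_exp {B : ℝ} (hB : 0 ≤ B) (k : ℕ) : factorialWeight B k ≤ Real.exp B := by
  refine le_trans ?_ (Real.pow_div_factorial_le_exp B hB k)
  rw [factorialWeight, div_pow]
  gcongr
  exact factorial_le_succ_pow k

theorem factorialWeight_add_le {B : ℝ} (hB : 0 ≤ B) (k j : ℕ) :
    factorialWeight B (k + j) ≤ Real.exp B * factorialWeight B k := by
  calc factorialWeight B (k + j)
      = (B / ((k + j : ℕ) + 1)) ^ k * (B / ((k + j : ℕ) + 1)) ^ j := by
        rw [factorialWeight, pow_add]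
    _ ≤ (B / (k + 1)) ^ k * (B / (j + 1)) ^ j := by
        gcongr <;> simp
    _ ≤ (B / (k + 1)) ^ k * Real.exp B := by
        gcongr
        exact factorialWeight_le_exp hB j
    _ = _ := mul_comm _ _

theorem factorialWeight_rpow_add_le {B : ℝ} (hB : 0 ≤ B) (k j : ℕ) :
    factorialWeight B (k + j) ^ (2 / 3 : ℝ)
      ≤ Real.exp B ^ (2 / 3 : ℝ) * factorialWeight B k ^ (2 / 3 : ℝ) := by
  rw [← Real.mul_rpow (Real.exp_pos _).le (factorialWeight_nonneg hB k)]
  exact Real.rpow_le_rpow (factorialWeight_nonneg hB _) (factorialWeight_add_le hB k j)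
    (by norm_num)

/-- The derivatives grow like `(k!)^(1/3)`, uniformly on `[a, ∞)`; this uses the contour at height
`η = (k + 1)^(1/3)`. -/
theorem exists_airyTailDeriv_growth (a : ℝ) :
    ∃ C : ℝ, 1 ≤ C ∧ ∀ (k j : ℕ) (x : ℝ), a ≤ x → (j = k ∨ j = k + 1) →
      |airyTailDeriv j x|
        ≤ C ^ (k + 1) * (((k : ℝ) + 1) ^ k) ^ (1 / 3 : ℝ) * Real.exp (-(x - a)) := by
  refine ⟨2 * Real.exp (1 + |a|), ?_, fun k j x hx hj => ?_⟩
  · nlinarith [Real.one_le_exp (show 0 ≤ 1 + |a| by positivity)]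
  have hk1 : (1 : ℝ) ≤ (k : ℝ) + 1 := by simp
  set η : ℝ := ((k : ℝ) + 1) ^ (1 / 3 : ℝ) with hη
  have hη1 : 1 ≤ η := Real.one_le_rpow hk1 (by norm_num)
  have hη3 : η ^ 3 = (k : ℝ) + 1 := by
    rw [hη, ← Real.rpow_natCast, ← Real.rpow_mul (by positivity)]
    norm_num
  have hηk : η ^ k = (((k : ℝ) + 1) ^ k) ^ (1 / 3 : ℝ) := by
    rw [hη, Real.rpow_pow_comm (by positivity)]
  have hη_le : η ≤ (k : ℝ) + 1 := by
    rw [← hη3]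
    exact le_self_pow₀ hη1 (by norm_num)
  have h := abs_airyContour_le hη1 (k := k) (by rw [hη3]; simp) x hj
  rw [airyTailDeriv_eq_airyContour (by linarith : 0 < η)]
  refine h.trans ?_
  have he : Real.exp (η ^ 3 / 3 - x * η)
      ≤ Real.exp (1 + |a|) ^ (k + 1) * Real.exp (-(x - a)) := by
    rw [← Real.exp_nat_mul, ← Real.exp_add, Real.exp_le_exp, hη3]
    push_cast
    have h1 : x - a ≤ (x - a) * η := le_mul_of_one_le_right (by linarith) hη1
    have h2 : -a * η ≤ |a| * ((k : ℝ) + 1) :=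
      (mul_le_mul_of_nonneg_right (neg_le_abs a) (by linarith)).trans
        (mul_le_mul_of_nonneg_left hη_le (abs_nonneg a))
    nlinarith
  have h2 : (2 : ℝ) ≤ 2 ^ (k + 1) := le_self_pow₀ one_le_two (by simp)
  calc 2 * η ^ k * Real.exp (η ^ 3 / 3 - x * η)
      ≤ 2 ^ (k + 1) * η ^ k * (Real.exp (1 + |a|) ^ (k + 1) * Real.exp (-(x - a))) := by gcongr
    _ = _ := by rw [hηk, mul_pow]; ring

/-- The polynomials `hᵏ` (for `a = 0`) and `-(hᵏ)'` (for `a = 1`): the Taylor expansions at `x` are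
`f(x + h) = ∑ taylorRow h 0 k * f⁽ᵏ⁾(x) / k!` and `-f'(x + h) = ∑ taylorRow h 1 k * f⁽ᵏ⁾(x) / k!`.
For `k = 0` the truncated exponent `k - 1` is harmless because of the factor `k`. -/
noncomputable def taylorRow (h : ℝ) (a : Fin 2) (k : ℕ) : ℝ :=
  if a = 0 then h ^ k else -(k * h ^ (k - 1))

theorem abs_taylorRow_le {h l : ℝ} (hl : 1 ≤ l) (hh : |h| ≤ l) (a : Fin 2) (k : ℕ) :
    |taylorRow h a k| ≤ (2 * l) ^ k := by
  have hl0 : 0 ≤ l := by linarith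
  have h2 : (1 : ℝ) ≤ 2 ^ k := one_le_pow₀ one_le_two
  rw [taylorRow, mul_pow]
  split_ifs
  · rw [abs_pow]
    calc |h| ^ k ≤ l ^ k := by gcongr
      _ ≤ 2 ^ k * l ^ k := le_mul_of_one_le_left (by positivity) h2
  · rw [abs_neg, abs_mul, abs_pow, Nat.abs_cast]
    have hk : (k : ℝ) ≤ 2 ^ k := by exact_mod_cast k.lt_two_pow_self.le
    calc (k : ℝ) * |h| ^ (k - 1) ≤ 2 ^ k * l ^ (k - 1) := by gcongr
      _ ≤ 2 ^ k * l ^ k := by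
          gcongr
          exact k.sub_le 1

theorem hasSum_taylorRow (a : Fin 2) (j : ℕ) (x h : ℝ) :
    HasSum (fun k : ℕ => taylorRow h a k * (airyTailDeriv (j + k) x / k.factorial))
      ((-1) ^ (a : ℕ) * airyTailDeriv (a + j) (x + h)) := by
  fin_cases a
  · simp only [taylorRow]
    have := hasSum_airyContour one_pos j x h
    simp only [Fin.zero_eta, if_true, pow_zero, one_mul, zero_add]
    refine this.congr_fun fun k => ?_
    simp only [airyTailDeriv]
    ring
  -- The `k = 0` term vanishes, and the others are the expansion of the derivative, shifted by one.
  · have := (hasSum_airyContour one_pos (j + 1) x h).neg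
    rw [← hasSum_nat_add_iff' 1]
    simp only [Finset.sum_range_one, taylorRow]
    simp only [Fin.mk_one, Fin.isValue, one_ne_zero, if_false, Nat.cast_zero, zero_mul, neg_zero,
      sub_zero, pow_one, neg_mul, one_mul, Nat.add_sub_cancel]
    rw [add_comm 1 j]
    refine this.congr_fun fun k => ?_
    simp only [airyTailDeriv]
    rw [Nat.factorial_succ, show j + (k + 1) = j + 1 + k by ring]
    push_cast
    have : (k : ℝ) + 1 ≠ 0 := by positivity
    field_simp

/-- Majorants `v` and `c` for the Taylor rows and for the Taylor coefficients on `[a, ∞)`; the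
product decays like `(k!)^(-2/3)`, up to a geometric factor, because the Airy function is of
order `3/2`. -/
theorem exists_taylor_weights (a L : ℝ) :
    ∃ (A B : ℝ) (v c : ℕ → ℝ), 0 ≤ A ∧ 0 ≤ B ∧ (∀ k, 0 ≤ v k) ∧ (∀ k, 0 ≤ c k) ∧
      (∀ h, |h| ≤ L → ∀ e k, |taylorRow h e k| ≤ v k) ∧
      (∀ (k j : ℕ) (x : ℝ), a ≤ x → (j = k ∨ j = k + 1) →
        |airyTailDeriv j x / k.factorial| ≤ c k * Real.exp (-(x - a))) ∧
      ∀ k, v k * c k ≤ A * (1 / 2) ^ k * factorialWeight B k ^ (2 / 3 : ℝ) := by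
  obtain ⟨C, hC1, hC⟩ := exists_airyTailDeriv_growth a
  set l := max 1 L with hl
  have hl1 : 1 ≤ l := le_max_left _ _
  have hC0 : 0 < C := by linarith
  set β := 4 * l * C * Real.exp 1 with hβ
  have hβ0 : 0 < β := by positivity
  refine ⟨C * Real.exp 1, β ^ (3 / 2 : ℝ), fun k => (2 * l) ^ k,
    fun k => C ^ (k + 1) * (((k : ℝ) + 1) ^ k) ^ (1 / 3 : ℝ) / k.factorial,
    by positivity, by positivity, fun k => by positivity, fun k => by positivity,
    fun h hh e k => abs_taylorRow_le hl1 (hh.trans (le_max_right _ _)) e k,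
    fun k j x hx hj => ?_, fun k => ?_⟩
  · rw [abs_div, Nat.abs_cast, div_mul_eq_mul_div]
    gcongr
    exact hC k j x hx hj
  · set P : ℝ := ((k : ℝ) + 1) ^ k with hP
    have hP0 : 0 < P := by positivity
    have e1 : factorialWeight (β ^ (3 / 2 : ℝ)) k ^ (2 / 3 : ℝ) = β ^ k / P ^ (2 / 3 : ℝ) := by
      rw [factorialWeight, div_pow, ← hP, Real.div_rpow (by positivity) hP0.le,
        ← Real.rpow_pow_comm (by positivity), ← Real.rpow_mul hβ0.le]
      norm_num
    -- `P^(1/3) / k! = (P / k!) P^(-2/3)`, and `P / k!` grows at most geometrically.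
    have e2 : P / k.factorial ≤ Real.exp 1 ^ (k + 1) := by
      rw [← Real.exp_nat_mul, mul_one]
      push_cast
      exact Real.pow_div_factorial_le_exp _ (by positivity) k
    have e3 : P ^ (1 / 3 : ℝ) = P / P ^ (2 / 3 : ℝ) := by
      rw [eq_div_iff (by positivity), ← Real.rpow_add hP0]
      norm_num
    rw [e1]
    change (2 * l) ^ k * (C ^ (k + 1) * P ^ (1 / 3 : ℝ) / k.factorial) ≤ _
    rw [e3]
    calc (2 * l) ^ k * (C ^ (k + 1) * (P / P ^ (2 / 3 : ℝ)) / k.factorial)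
        = (2 * l) ^ k * C ^ (k + 1) * (P / k.factorial) / P ^ (2 / 3 : ℝ) := by ring
      _ ≤ (2 * l) ^ k * C ^ (k + 1) * Real.exp 1 ^ (k + 1) / P ^ (2 / 3 : ℝ) := by gcongr
      _ = (1 / 2 * (4 * l)) ^ k * C ^ (k + 1) * Real.exp 1 ^ (k + 1) / P ^ (2 / 3 : ℝ) := by
          congr 4; ring
      _ = _ := by rw [hβ]; simp only [mul_pow, pow_succ]; ring

/-- The Taylor coefficients of the kernel at `(s, s)`. -/
noncomputable def kernelCoeff (s : ℝ) (k l : ℕ) : ℝ :=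
  (1 / 2 * airyPairing k (l + 1) s s + 1 / 4 * airyTailDeriv k s * airyTailDeriv l s) /
    (k.factorial * l.factorial)

theorem kernelCoeff_eq (s : ℝ) (k l : ℕ) :
    kernelCoeff s k l = 1 / 2 * (∫ z in Set.Ioi (0 : ℝ),
        airyTailDeriv k (s + z) / k.factorial * (airyTailDeriv (l + 1) (s + z) / l.factorial))
      + 1 / 4 * (airyTailDeriv k s / k.factorial) * (airyTailDeriv l s / l.factorial) := by
  have : ∀ z, airyTailDeriv k (s + z) / k.factorial * (airyTailDeriv (l + 1) (s + z) / l.factorial)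
      = airyTailDeriv k (s + z) * airyTailDeriv (l + 1) (s + z) *
        (1 / (k.factorial * l.factorial) : ℝ) := fun z => by ring
  simp only [this]
  rw [integral_mul_const, kernelCoeff, airyPairing]
  ring

theorem abs_airyTailDeriv_div_le {a : ℝ} {c : ℕ → ℝ} (hc0 : ∀ k, 0 ≤ c k)
    (hc : ∀ (k j : ℕ) (x : ℝ), a ≤ x → (j = k ∨ j = k + 1) →
      |airyTailDeriv j x / k.factorial| ≤ c k * Real.exp (-(x - a)))
    {s : ℝ} (hs : a < s) {k j : ℕ} (hj : j = k ∨ j = k + 1) {z : ℝ}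
    (hz : 0 ≤ z) : |airyTailDeriv j (s + z) / k.factorial| ≤ c k * Real.exp (-z) := by
  refine (hc k j (s + z) (by linarith) hj).trans ?_
  have := hc0 k
  gcongr
  linarith

theorem abs_kernelCoeff_le {a : ℝ} {c : ℕ → ℝ} (hc0 : ∀ k, 0 ≤ c k)
    (hc : ∀ (k j : ℕ) (x : ℝ), a ≤ x → (j = k ∨ j = k + 1) →
      |airyTailDeriv j x / k.factorial| ≤ c k * Real.exp (-(x - a)))
    {s : ℝ} (hs : a < s) (k l : ℕ) :
    |kernelCoeff s k l| ≤ c k * c l := by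
  have hkl := mul_nonneg (hc0 k) (hc0 l)
  have h1 : |∫ z in Set.Ioi (0 : ℝ), airyTailDeriv k (s + z) / k.factorial *
      (airyTailDeriv (l + 1) (s + z) / l.factorial)| ≤ c k * c l := by
    have := norm_integral_le_of_norm_le ((integrableOn_exp_neg_Ioi 0).const_mul (c k * c l))
      (f := fun z => airyTailDeriv k (s + z) / k.factorial *
        (airyTailDeriv (l + 1) (s + z) / l.factorial)) (by
      filter_upwards [ae_restrict_mem measurableSet_Ioi] with z hz
      have hz0 : (0 : ℝ) ≤ z := le_of_lt hz
      rw [Real.norm_eq_abs, abs_mul]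
      calc _ ≤ (c k * Real.exp (-z)) * (c l * Real.exp (-z)) :=
            mul_le_mul (abs_airyTailDeriv_div_le hc0 hc hs (.inl rfl) hz0)
              (abs_airyTailDeriv_div_le hc0 hc hs (.inr rfl) hz0) (abs_nonneg _)
              (mul_nonneg (hc0 k) (Real.exp_pos _).le)
        _ = c k * c l * Real.exp (-z) * Real.exp (-z) := by ring
        _ ≤ c k * c l * Real.exp (-z) :=
            mul_le_of_le_one_right (by positivity) (Real.exp_le_one_iff.2 (by linarith)))
    rwa [integral_const_mul, integral_exp_neg_Ioi_zero, mul_one] at this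
  have h2 : |airyTailDeriv k s / k.factorial * (airyTailDeriv l s / l.factorial)| ≤ c k * c l := by
    have hk := abs_airyTailDeriv_div_le hc0 hc hs (k := k) (.inl rfl) le_rfl
    have hl := abs_airyTailDeriv_div_le hc0 hc hs (k := l) (.inl rfl) le_rfl
    simp only [add_zero, neg_zero, Real.exp_zero, mul_one] at hk hl
    rw [abs_mul]
    exact mul_le_mul hk hl (abs_nonneg _) (hc0 k)
  rw [kernelCoeff_eq, mul_assoc (1 / 4 : ℝ)]
  rw [abs_le] at *
  constructor <;> linarith [h1.1, h1.2, h2.1, h2.2]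

/-- The kernel is the limit of its Taylor polynomials at `(s, s)`; the integral over `z` is
controlled by dominated convergence. -/
theorem tendsto_sum_kernelCoeff {a : ℝ} {c : ℕ → ℝ} (hc0 : ∀ k, 0 ≤ c k)
    (hc : ∀ (k j : ℕ) (x : ℝ), a ≤ x → (j = k ∨ j = k + 1) →
      |airyTailDeriv j x / k.factorial| ≤ c k * Real.exp (-(x - a)))
    {L D s : ℝ} {v : ℕ → ℝ} (hv0 : ∀ k, 0 ≤ v k)
    (hv : ∀ h, |h| ≤ L → ∀ e k, |taylorRow h e k| ≤ v k)
    (hD : ∀ N, ∑ k ∈ Finset.range N, v k * c k ≤ D) (hs : a < s) {x y : ℝ}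
    (hx : |x - s| ≤ L) (hy : |y - s| ≤ L) (e f : Fin 2) :
    Tendsto (fun N => ∑ k ∈ Finset.range N, ∑ l ∈ Finset.range N,
        taylorRow (x - s) e k * kernelCoeff s k l * taylorRow (y - s) f l) atTop
      (𝓝 (symplecticAiryKernel x y e f)) := by
  set F : ℕ → ℝ → ℝ := fun N z => ∑ k ∈ Finset.range N,
    taylorRow (x - s) e k * (airyTailDeriv k (s + z) / k.factorial) with hF
  set G : ℕ → ℝ → ℝ := fun N z => ∑ l ∈ Finset.range N,
    taylorRow (y - s) f l * (airyTailDeriv l (s + z) / l.factorial) with hG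
  set G' : ℕ → ℝ → ℝ := fun N z => ∑ l ∈ Finset.range N,
    taylorRow (y - s) f l * (airyTailDeriv (l + 1) (s + z) / l.factorial) with hG'
  have hFlim : ∀ z, Tendsto (fun N => F N z) atTop
      (𝓝 ((-1) ^ (e : ℕ) * airyTailDeriv e (x + z))) := fun z => by
    have := (hasSum_taylorRow e 0 (s + z) (x - s)).tendsto_sum_nat
    simpa only [zero_add, add_zero, add_add_sub_cancel, add_comm z x,
      show s + z + (x - s) = x + z by ring] using this
  have hGlim : ∀ z, Tendsto (fun N => G N z) atTop
      (𝓝 ((-1) ^ (f : ℕ) * airyTailDeriv f (y + z))) := fun z => by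
    have := (hasSum_taylorRow f 0 (s + z) (y - s)).tendsto_sum_nat
    simpa only [zero_add, add_zero, show s + z + (y - s) = y + z by ring] using this
  have hG'lim : ∀ z, Tendsto (fun N => G' N z) atTop
      (𝓝 ((-1) ^ (f : ℕ) * airyTailDeriv (f + 1) (y + z))) := fun z => by
    have := (hasSum_taylorRow f 1 (s + z) (y - s)).tendsto_sum_nat
    simpa only [show s + z + (y - s) = y + z by ring, add_comm 1] using this
  have hbound : ∀ (h : ℝ) (_ : |h| ≤ L) (e : Fin 2) (j : ℕ) (_ : j = 0 ∨ j = 1) (N : ℕ) (z : ℝ)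
      (_ : 0 ≤ z), |∑ k ∈ Finset.range N, taylorRow h e k *
        (airyTailDeriv (k + j) (s + z) / k.factorial)| ≤ D * Real.exp (-z) := by
    intro h hh e j hj N z hz
    refine (Finset.abs_sum_le_sum_abs _ _).trans ?_
    calc _ ≤ ∑ k ∈ Finset.range N, v k * c k * Real.exp (-z) := by
          refine Finset.sum_le_sum fun k _ => ?_
          rw [abs_mul, mul_assoc]
          refine mul_le_mul (hv h hh e k) ?_ (abs_nonneg _) (hv0 k)
          exact abs_airyTailDeriv_div_le hc0 hc hs (by rcases hj with rfl | rfl <;> simp) hz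
      _ ≤ _ := by
          rw [← Finset.sum_mul]
          exact mul_le_mul_of_nonneg_right (hD N) (Real.exp_pos _).le
  have hcont : ∀ (k j : ℕ), Continuous fun z => airyTailDeriv j (s + z) / k.factorial := fun k j =>
    ((continuous_airyTailDeriv j).comp (continuous_const_add s)).div_const _
  have hFc : ∀ N, Continuous (F N) := fun N =>
    continuous_finsetSum _ fun k _ => (hcont k _).const_mul _
  have hGc : ∀ N, Continuous (G' N) := fun N =>
    continuous_finsetSum _ fun k _ => (hcont k _).const_mul _
  have hD0 : 0 ≤ D := by simpa using hD 0
  have hint := tendsto_integral_filter_of_dominated_convergence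
    (μ := volume.restrict (Set.Ioi (0 : ℝ))) (l := atTop)
    (F := fun N z => F N z * G' N z) (fun z => D * D * Real.exp (-z))
    (Eventually.of_forall fun N => ((hFc N).mul (hGc N)).aestronglyMeasurable)
    (Eventually.of_forall fun N => by
      filter_upwards [ae_restrict_mem measurableSet_Ioi] with z hz
      have hz0 : (0 : ℝ) ≤ z := le_of_lt hz
      rw [Real.norm_eq_abs, abs_mul]
      calc _ ≤ (D * Real.exp (-z)) * (D * Real.exp (-z)) :=
            mul_le_mul (hbound _ hx e 0 (.inl rfl) N z hz0) (hbound _ hy f 1 (.inr rfl) N z hz0)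
              (abs_nonneg _) (by positivity)
        _ = D * D * Real.exp (-z) * Real.exp (-z) := by ring
        _ ≤ D * D * Real.exp (-z) :=
            mul_le_of_le_one_right (by positivity) (Real.exp_le_one_iff.2 (by linarith)))
    ((integrableOn_exp_neg_Ioi 0).const_mul _)
    (ae_of_all _ fun z => (hFlim z).mul (hG'lim z))
  have hlim := (hint.const_mul (1 / 2)).add (((hFlim 0).mul (hGlim 0)).const_mul (1 / 4))
  have hval : symplecticAiryKernel x y e f
      = 1 / 2 * (∫ z in Set.Ioi (0 : ℝ), (-1) ^ (e : ℕ) * airyTailDeriv e (x + z) *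
          ((-1) ^ (f : ℕ) * airyTailDeriv (f + 1) (y + z)))
        + 1 / 4 * ((-1) ^ (e : ℕ) * airyTailDeriv e (x + 0) *
          ((-1) ^ (f : ℕ) * airyTailDeriv f (y + 0))) := by
    have : ∀ z, (-1) ^ (e : ℕ) * airyTailDeriv e (x + z) *
          ((-1) ^ (f : ℕ) * airyTailDeriv (f + 1) (y + z))
        = (-1) ^ (e : ℕ) * (-1) ^ (f : ℕ) *
          (airyTailDeriv e (x + z) * airyTailDeriv (f + 1) (y + z)) := fun z => by ring
    simp only [this]
    rw [integral_const_mul, symplecticAiryKernel_eq, airyPairing, add_zero, add_zero]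
    ring
  rw [hval]
  refine hlim.congr fun N => ?_
  have hprod : ∀ z, F N z * G' N z = ∑ k ∈ Finset.range N, ∑ l ∈ Finset.range N,
      taylorRow (x - s) e k * taylorRow (y - s) f l *
        (airyTailDeriv k (s + z) / k.factorial *
          (airyTailDeriv (l + 1) (s + z) / l.factorial)) := by
    intro z
    rw [hF, hG', Finset.sum_mul_sum]
    refine Finset.sum_congr rfl fun k _ => Finset.sum_congr rfl fun l _ => ?_
    ring
  have hintegrable : ∀ k l : ℕ, IntegrableOn (fun z => airyTailDeriv k (s + z) / k.factorial *
      (airyTailDeriv (l + 1) (s + z) / l.factorial)) (Set.Ioi 0) := fun k l => by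
    refine ((integrableOn_mul_airyTailDeriv k (l + 1) s s).mul_const
      (1 / (k.factorial * l.factorial) : ℝ)).congr (ae_of_all _ fun z => ?_)
    simp only
    ring
  simp only [hprod]
  rw [integral_finsetSum _ fun k _ => integrable_finsetSum _ fun l _ =>
    (hintegrable k l).const_mul _]
  simp only [integral_finsetSum _ fun l _ => (hintegrable _ l).const_mul _, integral_const_mul]
  rw [hF, hG, Finset.sum_mul_sum]
  simp only [Finset.mul_sum, ← Finset.sum_add_distrib, add_zero]
  refine Finset.sum_congr rfl fun k _ => Finset.sum_congr rfl fun l _ => ?_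
  rw [kernelCoeff_eq]
  ring

/-- A bound on the correlation functions which is uniform in the window `[s, s + L]` with `s > a`:
the Taylor polynomials of the kernel give matrices of the form `V C Vᵀ`, and the Pfaffian bound for
these does not depend on the degree. -/
theorem exists_abs_pfaffian_symplecticAiryKernel_le (a L : ℝ) :
    ∃ A B : ℝ, 0 ≤ A ∧ 0 ≤ B ∧ ∀ s, a < s → ∀ (n : ℕ) (x : Fin n → ℝ),
      (∀ i, x i ∈ Set.Icc s (s + L)) →
      |pfaffian (Matrix.of fun p q : Fin n × Fin 2 =>
          symplecticAiryKernel (x p.1) (x q.1) p.2 q.2)|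
        ≤ (2 * n).factorial * A ^ (2 * n) *
          (∏ i ∈ Finset.range (2 * n), factorialWeight B i) ^ (2 / 3 : ℝ) := by
  obtain ⟨A, B, v, c, hA, hB, hv0, hc0, hv, hc, hvc⟩ := exists_taylor_weights a L
  -- `S` is both a bound for the weights and the constant of their quasi-monotonicity.
  set S := Real.exp B ^ (2 / 3 : ℝ) with hS
  have hS0 : 0 ≤ S := by positivity
  have hq0 : ∀ k, 0 ≤ factorialWeight B k ^ (2 / 3 : ℝ) := fun k =>
    Real.rpow_nonneg (factorialWeight_nonneg hB k) _
  refine ⟨2 * A * S, B, by positivity, hB, fun s hs n x hx => ?_⟩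
  have hD : ∀ N, ∑ k ∈ Finset.range N, v k * c k ≤ A * S * 2 := fun N => by
    calc ∑ k ∈ Finset.range N, v k * c k
        ≤ ∑ k ∈ Finset.range N, A * S * (1 / 2) ^ k := by
          refine Finset.sum_le_sum fun k _ => (hvc k).trans ?_
          have : factorialWeight B k ^ (2 / 3 : ℝ) ≤ S :=
            Real.rpow_le_rpow (factorialWeight_nonneg hB k) (factorialWeight_le_exp hB k)
              (by norm_num)
          calc A * (1 / 2) ^ k * factorialWeight B k ^ (2 / 3 : ℝ)
              ≤ A * (1 / 2) ^ k * S := by gcongr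
            _ = _ := by ring
      _ ≤ A * S * 2 := by
          rw [← Finset.mul_sum]
          gcongr
          exact sum_geometric_two_le N
  have hxs : ∀ i, |x i - s| ≤ L := fun i => by
    rw [abs_of_nonneg (by linarith [(hx i).1])]
    linarith [(hx i).2]
  have hlim : Tendsto (fun N => Matrix.of fun p q : Fin n × Fin 2 =>
      ∑ k ∈ Finset.range N, ∑ l ∈ Finset.range N,
        taylorRow (x p.1 - s) p.2 k * kernelCoeff s k l * taylorRow (x q.1 - s) q.2 l) atTop
      (𝓝 (Matrix.of fun p q : Fin n × Fin 2 =>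
        symplecticAiryKernel (x p.1) (x q.1) p.2 q.2)) := by
    refine tendsto_pi_nhds.2 fun p => tendsto_pi_nhds.2 fun q => ?_
    exact tendsto_sum_kernelCoeff hc0 hc hv0 hv hD hs (hxs p.1) (hxs q.1) p.2 q.2
  refine le_of_tendsto ((continuous_pfaffian.tendsto _).comp hlim).abs
    (Eventually.of_forall fun N => ?_)
  have := abs_pfaffian_congruence_le (N := N)
    (fun (p : Fin n × Fin 2) k => taylorRow (x p.1 - s) p.2 k) (kernelCoeff s) hA hS0 hq0
    (factorialWeight_rpow_add_le hB) (fun p k => hv _ (hxs p.1) p.2 k)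
    (abs_kernelCoeff_le hc0 hc hs) hc0 hvc
  rwa [Real.finsetProd_rpow _ _ fun i _ => factorialWeight_nonneg hB i] at this

/-! ### Tails of the number of particles -/

/-- The product of the first `2n` weights is of the order of `n ^ (-2n²)`. -/
theorem prod_factorialWeight_le {B : ℝ} (hB : 1 ≤ B) {n : ℕ} (hn : 1 ≤ n) :
    ∏ i ∈ Finset.range (2 * n), factorialWeight B i
      ≤ (B ^ 2 * Real.exp 6) ^ n ^ 2 / ((n : ℝ) ^ 2) ^ n ^ 2 := by
  have hn0 : (0 : ℝ) < n := by exact_mod_cast hn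
  set m : ℝ := 2 * n with hm
  have hm0 : 0 < m := by positivity
  -- `(m / (i + 1))^i ≤ m^i / i! ≤ exp m` replaces all the denominators by `m = 2n`.
  have hterm : ∀ i ∈ Finset.range (2 * n), factorialWeight B i ≤ B ^ i * Real.exp m / m ^ i := by
    intro i _
    rw [factorialWeight, div_pow, div_le_div_iff₀ (by positivity) (by positivity), mul_assoc]
    have h := Real.pow_div_factorial_le_exp m hm0.le i
    rw [div_le_iff₀ (by positivity)] at h
    have h2 := factorial_le_succ_pow i
    gcongr
    exact h.trans (by gcongr)
  have hsum : ∑ i ∈ Finset.range (2 * n), i = n * (2 * n - 1) := by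
    rw [Finset.sum_range_id, mul_assoc, Nat.mul_div_cancel_left _ two_pos]
  have hexp : n * (2 * n - 1) + n = 2 * n ^ 2 := by
    obtain ⟨k, rfl⟩ : ∃ k, n = k + 1 := ⟨n - 1, by omega⟩
    rw [show 2 * (k + 1) - 1 = 2 * k + 1 by omega]
    ring
  refine (Finset.prod_le_prod (fun i _ => factorialWeight_nonneg (by linarith) i) hterm).trans ?_
  rw [Finset.prod_div_distrib, Finset.prod_mul_distrib, Finset.prod_pow_eq_pow_sum,
    Finset.prod_pow_eq_pow_sum, Finset.prod_const, Finset.card_range, hsum,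
    div_le_div_iff₀ (by positivity) (by positivity)]
  have h1 : B ^ (n * (2 * n - 1)) ≤ (B ^ 2) ^ n ^ 2 := by
    rw [← pow_mul]
    exact pow_le_pow_right₀ hB (by omega)
  have h2 : Real.exp m ^ (2 * n) = Real.exp 4 ^ n ^ 2 := by
    rw [← Real.exp_nat_mul, ← Real.exp_nat_mul, hm]
    congr 1
    push_cast
    ring
  have h3 : ((n : ℝ) ^ 2) ^ n ^ 2 ≤ Real.exp 2 ^ n ^ 2 * m ^ (n * (2 * n - 1)) := by
    calc ((n : ℝ) ^ 2) ^ n ^ 2 = (n : ℝ) ^ (2 * n ^ 2) := by rw [← pow_mul]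
      _ ≤ m ^ (2 * n ^ 2) := by gcongr; linarith
      _ = m ^ n * m ^ (n * (2 * n - 1)) := by rw [← hexp, pow_add]; ring
      _ ≤ Real.exp m ^ n * m ^ (n * (2 * n - 1)) := by
          gcongr
          linarith [Real.add_one_le_exp m]
      _ = _ := by
          rw [← Real.exp_nat_mul, ← Real.exp_nat_mul, hm]
          congr 2
          push_cast
          ring
  calc B ^ (n * (2 * n - 1)) * Real.exp m ^ (2 * n) * ((n : ℝ) ^ 2) ^ n ^ 2
      ≤ (B ^ 2) ^ n ^ 2 * Real.exp 4 ^ n ^ 2 *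
        (Real.exp 2 ^ n ^ 2 * m ^ (n * (2 * n - 1))) := by rw [h2]; gcongr
    _ = _ := by
      rw [show (6 : ℝ) = 4 + 2 by norm_num, Real.exp_add]
      simp only [mul_pow]
      ring

/-- The bound on the `n`-point function beats `t ^ (2n² / 3)` with room for a geometric factor:
with `N = n²` it is essentially `((D t)^N / N!)^(2/3)`. -/
theorem exists_weight_growth_le (A B L : ℝ) (hA : 0 ≤ A) (hB : 0 ≤ B) (hL : 0 ≤ L) :
    ∃ D : ℝ, 0 ≤ D ∧ ∀ (n : ℕ) (t : ℝ), 1 ≤ t →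
      (n : ℝ) ^ 2 * (t ^ n ^ 2) ^ (2 / 3 : ℝ) * ((2 * n).factorial * A ^ (2 * n) *
        (∏ i ∈ Finset.range (2 * n), factorialWeight B i) ^ (2 / 3 : ℝ) * L ^ n)
        ≤ (1 / 2) ^ n * Real.exp (D * t) := by
  set A₁ := max 1 A with hA₁
  set B₁ := max 1 B with hB₁
  set L₁ := max 1 L with hL₁
  have hA1 : 1 ≤ A₁ := le_max_left _ _
  have hB1 : 1 ≤ B₁ := le_max_left _ _
  have hL1 : 1 ≤ L₁ := le_max_left _ _
  set H := Real.exp 5 * A₁ ^ 2 * L₁ * 2 with hH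
  set G := B₁ ^ 2 * Real.exp 6 with hG
  have hH1 : 1 ≤ H := by
    have h5 : 1 ≤ Real.exp 5 := Real.one_le_exp (by norm_num)
    have hA2 : 1 ≤ A₁ ^ 2 := one_le_pow₀ hA1
    exact one_le_mul_of_one_le_of_one_le (one_le_mul_of_one_le_of_one_le
      (one_le_mul_of_one_le_of_one_le h5 hA2) hL1) one_le_two
  have hG0 : 0 < G := by positivity
  refine ⟨H ^ 2 * G, by positivity, fun n t ht => ?_⟩
  have ht0 : 0 < t := by linarith
  rcases Nat.eq_zero_or_pos n with rfl | hn
  · simpa using (Real.exp_pos _).le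
  have hn2 : n ≤ n ^ 2 := Nat.le_self_pow two_ne_zero n
  have hn0 : (0 : ℝ) < n := by exact_mod_cast hn
  have hnexp : (2 * n : ℝ) ≤ Real.exp (2 * n) := by linarith [Real.add_one_le_exp (2 * n : ℝ)]
  have hpre : (n : ℝ) ^ 2 * ((2 * n).factorial * A ^ (2 * n) * L ^ n) * 2 ^ n ≤ H ^ n ^ 2 := by
    have f1 : (n : ℝ) ^ 2 ≤ Real.exp 1 ^ n ^ 2 := by
      rw [← Real.exp_nat_mul]
      push_cast
      linarith [Real.add_one_le_exp ((n : ℝ) ^ 2 * 1)]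
    have f2 : ((2 * n).factorial : ℝ) ≤ Real.exp 4 ^ n ^ 2 := by
      calc ((2 * n).factorial : ℝ) ≤ (2 * n : ℝ) ^ (2 * n) := by
            exact_mod_cast (2 * n).factorial_le_pow
        _ ≤ Real.exp (2 * n) ^ (2 * n) := by gcongr
        _ = _ := by
            rw [← Real.exp_nat_mul, ← Real.exp_nat_mul]
            congr 1
            push_cast
            ring
    have f3 : A ^ (2 * n) ≤ (A₁ ^ 2) ^ n ^ 2 := by
      calc A ^ (2 * n) ≤ A₁ ^ (2 * n) := by gcongr; exact le_max_right _ _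
        _ ≤ A₁ ^ (2 * n ^ 2) := pow_le_pow_right₀ hA1 (by omega)
        _ = _ := by rw [pow_mul]
    have f4 : L ^ n ≤ L₁ ^ n ^ 2 := by
      calc L ^ n ≤ L₁ ^ n := by gcongr; exact le_max_right _ _
        _ ≤ _ := pow_le_pow_right₀ hL1 hn2
    have f5 : (2 : ℝ) ^ n ≤ 2 ^ n ^ 2 := pow_le_pow_right₀ one_le_two hn2
    calc _ ≤ Real.exp 1 ^ n ^ 2 * (Real.exp 4 ^ n ^ 2 * (A₁ ^ 2) ^ n ^ 2 * L₁ ^ n ^ 2) *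
          2 ^ n ^ 2 := by gcongr
      _ = _ := by
        rw [hH, show (5 : ℝ) = 1 + 4 by norm_num, Real.exp_add]
        simp only [mul_pow]
        ring
  set Q := ∏ i ∈ Finset.range (2 * n), factorialWeight B i with hQ
  have hQ0 : 0 ≤ Q := Finset.prod_nonneg fun i _ => factorialWeight_nonneg hB i
  have hQle : Q ≤ G ^ n ^ 2 / ((n : ℝ) ^ 2) ^ n ^ 2 := by
    refine le_trans ?_ (prod_factorialWeight_le hB1 hn)
    refine Finset.prod_le_prod (fun i _ => factorialWeight_nonneg hB i) fun i _ => ?_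
    unfold factorialWeight
    gcongr
    exact le_max_right _ _
  have hHpow : H ^ n ^ 2 ≤ ((H ^ 2) ^ n ^ 2) ^ (2 / 3 : ℝ) := by
    rw [← Real.rpow_pow_comm (by positivity), ← Real.rpow_natCast H 2,
      ← Real.rpow_mul (by positivity)]
    refine pow_le_pow_left₀ (by positivity) ?_ _
    exact (Real.rpow_one H).symm.le.trans
      (Real.rpow_le_rpow_of_exponent_le hH1 (by norm_num))
  have hmain : (H ^ 2) ^ n ^ 2 * t ^ n ^ 2 * Q ≤ Real.exp (H ^ 2 * G * t) := by
    calc (H ^ 2) ^ n ^ 2 * t ^ n ^ 2 * Q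
        ≤ (H ^ 2) ^ n ^ 2 * t ^ n ^ 2 * (G ^ n ^ 2 / ((n : ℝ) ^ 2) ^ n ^ 2) := by gcongr
      _ = (H ^ 2 * G * t) ^ n ^ 2 / ((n : ℝ) ^ 2) ^ n ^ 2 := by
          simp only [mul_pow]; ring
      _ ≤ (H ^ 2 * G * t) ^ n ^ 2 / (n ^ 2).factorial := by
          gcongr
          exact_mod_cast (n ^ 2).factorial_le_pow
      _ ≤ _ := Real.pow_div_factorial_le_exp _ (by positivity) _
  have hfinal : ((n : ℝ) ^ 2 * (t ^ n ^ 2) ^ (2 / 3 : ℝ) * ((2 * n).factorial * A ^ (2 * n) *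
        Q ^ (2 / 3 : ℝ) * L ^ n)) * 2 ^ n ≤ Real.exp (H ^ 2 * G * t) := by
    calc _ = ((n : ℝ) ^ 2 * ((2 * n).factorial * A ^ (2 * n) * L ^ n) * 2 ^ n) *
          ((t ^ n ^ 2) ^ (2 / 3 : ℝ) * Q ^ (2 / 3 : ℝ)) := by ring
      _ ≤ ((H ^ 2) ^ n ^ 2) ^ (2 / 3 : ℝ) * ((t ^ n ^ 2) ^ (2 / 3 : ℝ) * Q ^ (2 / 3 : ℝ)) := by
          gcongr
          exact hpre.trans hHpow
      _ = ((H ^ 2) ^ n ^ 2 * t ^ n ^ 2 * Q) ^ (2 / 3 : ℝ) := by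
          rw [Real.mul_rpow (by positivity) hQ0, Real.mul_rpow (by positivity) (by positivity)]
          ring
      _ ≤ Real.exp (H ^ 2 * G * t) ^ (2 / 3 : ℝ) :=
          Real.rpow_le_rpow (by positivity) hmain (by norm_num)
      _ ≤ _ := by
          conv_rhs => rw [← Real.rpow_one (Real.exp _)]
          exact Real.rpow_le_rpow_of_exponent_le (Real.one_le_exp (by positivity)) (by norm_num)
  rw [one_div, inv_pow, inv_mul_eq_div]
  exact (le_div_iff₀ (by positivity)).2 hfinal

theorem measurable_count {B : Set ℝ} (hB : MeasurableSet B) (hb : Bornology.IsBounded B) :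
    Measurable (Configuration.count B) := by
  have h : MeasurableSpace.comap (Configuration.count B) ⊤ ≤ Configuration.instMeasurableSpace :=
    le_iSup₂_of_le (f := fun (B : Set ℝ)
      (_ : B ∈ {B : Set ℝ | MeasurableSet B ∧ Bornology.IsBounded B}) =>
      MeasurableSpace.comap (Configuration.count B) ⊤) B ⟨hB, hb⟩ le_rfl
  intro s _
  exact h _ ⟨s, trivial, rfl⟩

/-- A bound `R` for the `n`-point function on `I ^ n` bounds the probability of exactly `n`
particles in `I`, through the `n`-th factorial moment. -/
theorem measure_count_eq_le {P : Measure Configuration} {ρ : (n : ℕ) → (Fin n → ℝ) → ℝ}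
    (hρ : HasCorrelationFunctions P ρ) {s L : ℝ} (hL : 0 ≤ L) {n : ℕ} {R : ℝ}
    (hR : ∀ x : Fin n → ℝ, (∀ i, x i ∈ Set.Icc s (s + L)) → ρ n x ≤ R) :
    P (Configuration.count (Set.Icc s (s + L)) ⁻¹' {n}) ≤ ENNReal.ofReal (R * L ^ n) := by
  have h := hρ.2 n 1 (fun _ => Set.Icc s (s + L)) (fun _ => 0) (fun _ => measurableSet_Icc)
    (fun _ => Metric.isBounded_Icc _ _) (fun i j hij => (hij (Subsingleton.elim i j)).elim)
  have hcard : ∀ i : Fin 1, Fintype.card {j : Fin n // (0 : Fin 1) = i} = n := fun i => by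
    rw [Fintype.card_subtype]
    simp [Subsingleton.elim (0 : Fin 1) i]
  simp only [Finset.univ_unique, Finset.prod_singleton, hcard] at h
  have hm := measurable_count (B := Set.Icc s (s + L)) measurableSet_Icc (Metric.isBounded_Icc _ _)
  have hvol : volume (Set.univ.pi fun _ : Fin n => Set.Icc s (s + L)) = ENNReal.ofReal L ^ n := by
    rw [volume_pi_pi]
    simp
  calc P (Configuration.count (Set.Icc s (s + L)) ⁻¹' {n})
      = ∫⁻ X, (Configuration.count (Set.Icc s (s + L)) ⁻¹' {n}).indicator 1 X ∂P := by
        rw [lintegral_indicator_one (hm (measurableSet_singleton n))]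
    _ ≤ ∫⁻ X, ((X.count (Set.Icc s (s + L))).descFactorial n : ENNReal) ∂P := by
        refine lintegral_mono fun X => Set.indicator_apply_le' (fun hX => ?_) fun _ => zero_le
        have hX : X.count (Set.Icc s (s + L)) = n := hX
        rw [hX, Nat.descFactorial_self]
        change (1 : ENNReal) ≤ _
        exact_mod_cast Nat.one_le_iff_ne_zero.2 n.factorial_ne_zero
    _ = ∫⁻ x in Set.univ.pi fun _ : Fin n => Set.Icc s (s + L), ENNReal.ofReal (ρ n x) := h
    _ ≤ ∫⁻ _ in Set.univ.pi fun _ : Fin n => Set.Icc s (s + L), ENNReal.ofReal R := by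
        refine setLIntegral_mono' (MeasurableSet.univ_pi fun _ => measurableSet_Icc) fun x hx => ?_
        exact ENNReal.ofReal_le_ofReal (hR x fun i => hx i trivial)
    _ = ENNReal.ofReal (R * L ^ n) := by
        rw [setLIntegral_const, hvol, ENNReal.ofReal_mul' (by positivity), ENNReal.ofReal_pow hL]

theorem mainTheorem8 (a L : ℝ) (hL : 0 < L) :
    ∃ d : ℝ, 0 < d ∧
      ∀ P : Measure Configuration, IsPfaffianPointProcess P symplecticAiryKernel →
        ∀ s : ℝ, a < s → ∀ lam : ℝ, 0 < lam →
          ∫⁻ X, ENNReal.ofReal (Real.exp (lam * (X.count (Set.Icc s (s + L)) : ℝ) ^ 2)) ∂P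
            ≤ ENNReal.ofReal (Real.exp (d * (Real.exp (3 * lam / 2) - 1))) := by
  obtain ⟨A, B, hA, hB, hpf⟩ := exists_abs_pfaffian_symplecticAiryKernel_le a L
  obtain ⟨D, hD, hgrowth⟩ := exists_weight_growth_le A B L hA hB hL.le
  refine ⟨D + 2 * Real.exp D, by positivity, fun P hP s hs lam hlam => ?_⟩
  obtain ⟨hprob, hcorr⟩ := hP
  set t := Real.exp (3 * lam / 2) with ht
  have ht1 : 1 ≤ t := Real.one_le_exp (by positivity)
  have hlamt : lam ≤ t - 1 := by linarith [Real.add_one_le_exp (3 * lam / 2)]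
  set N := Configuration.count (Set.Icc s (s + L)) with hN
  have hNm : Measurable N := measurable_count measurableSet_Icc (Metric.isBounded_Icc _ _)
  set R : ℕ → ℝ := fun n => (2 * n).factorial * A ^ (2 * n) *
    (∏ i ∈ Finset.range (2 * n), factorialWeight B i) ^ (2 / 3 : ℝ) * L ^ n with hR
  have hp : ∀ n, P (N ⁻¹' {n}) ≤ ENNReal.ofReal (R n) := fun n =>
    measure_count_eq_le hcorr hL.le fun x hx => (le_abs_self _).trans (hpf s hs n x hx)
  -- `exp u - 1 ≤ u exp u` for `u = lam * n²` produces the factor `t - 1`.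
  have hw : ∀ n : ℕ, Real.exp (lam * (n : ℝ) ^ 2)
      ≤ 1 + (t - 1) * ((n : ℝ) ^ 2 * (t ^ n ^ 2) ^ (2 / 3 : ℝ)) := by
    intro n
    have e1 : (t ^ n ^ 2) ^ (2 / 3 : ℝ) = Real.exp (lam * (n : ℝ) ^ 2) := by
      rw [ht, ← Real.exp_nat_mul, ← Real.exp_mul]
      congr 1
      push_cast
      ring
    rw [e1]
    set u := lam * (n : ℝ) ^ 2 with hu
    have h1 : (1 - u) * Real.exp u ≤ 1 := by
      calc (1 - u) * Real.exp u ≤ Real.exp (-u) * Real.exp u := by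
            gcongr
            linarith [Real.add_one_le_exp (-u)]
        _ = 1 := by rw [← Real.exp_add]; simp
    have h2 : u * Real.exp u ≤ (t - 1) * ((n : ℝ) ^ 2 * Real.exp u) := by
      rw [hu, mul_assoc]
      gcongr
    linarith
  have hsum : ∫⁻ X, ENNReal.ofReal (Real.exp (lam * (N X : ℝ) ^ 2)) ∂P
      = ∑' n : ℕ, ENNReal.ofReal (Real.exp (lam * (n : ℝ) ^ 2)) * P (N ⁻¹' {n}) := by
    rw [← lintegral_map (f := fun n : ℕ => ENNReal.ofReal (Real.exp (lam * (n : ℝ) ^ 2)))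
      (measurable_of_countable _) hNm, lintegral_countable']
    simp only [Measure.map_apply hNm (measurableSet_singleton _)]
  have htot : ∑' n : ℕ, P (N ⁻¹' {n}) = 1 := by
    have : ∑' n : ℕ, P.map N {n} = P.map N Set.univ := by
      simpa using (lintegral_countable' (μ := P.map N) fun _ : ℕ => 1).symm
    simp only [Measure.map_apply hNm (measurableSet_singleton _)] at this
    rw [this, Measure.map_apply hNm MeasurableSet.univ, Set.preimage_univ, measure_univ]
  have hterm : ∀ n : ℕ, ENNReal.ofReal (Real.exp (lam * (n : ℝ) ^ 2)) * P (N ⁻¹' {n})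
      ≤ P (N ⁻¹' {n}) + ENNReal.ofReal ((t - 1) * Real.exp (D * t) * (1 / 2) ^ n) := by
    intro n
    have hn0 : 0 ≤ (t - 1) * ((n : ℝ) ^ 2 * (t ^ n ^ 2) ^ (2 / 3 : ℝ)) :=
      mul_nonneg (by linarith) (by positivity)
    calc _ ≤ ENNReal.ofReal (1 + (t - 1) * ((n : ℝ) ^ 2 * (t ^ n ^ 2) ^ (2 / 3 : ℝ))) *
          P (N ⁻¹' {n}) := by gcongr; exact hw n
      _ = P (N ⁻¹' {n}) + ENNReal.ofReal ((t - 1) * ((n : ℝ) ^ 2 * (t ^ n ^ 2) ^ (2 / 3 : ℝ))) *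
          P (N ⁻¹' {n}) := by
          rw [ENNReal.ofReal_add zero_le_one hn0, ENNReal.ofReal_one, add_mul, one_mul]
      _ ≤ P (N ⁻¹' {n}) + ENNReal.ofReal ((t - 1) * ((n : ℝ) ^ 2 * (t ^ n ^ 2) ^ (2 / 3 : ℝ))) *
          ENNReal.ofReal (R n) := by gcongr; exact hp n
      _ ≤ _ := by
          rw [← ENNReal.ofReal_mul hn0]
          refine add_le_add le_rfl (ENNReal.ofReal_le_ofReal ?_)
          calc (t - 1) * ((n : ℝ) ^ 2 * (t ^ n ^ 2) ^ (2 / 3 : ℝ)) * R n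
              = (t - 1) * ((n : ℝ) ^ 2 * (t ^ n ^ 2) ^ (2 / 3 : ℝ) * R n) := by ring
            _ ≤ (t - 1) * ((1 / 2) ^ n * Real.exp (D * t)) :=
                mul_le_mul_of_nonneg_left (hgrowth n t ht1) (by linarith)
            _ = _ := by ring
  have hC0 : 0 ≤ (t - 1) * Real.exp (D * t) := mul_nonneg (by linarith) (Real.exp_pos _).le
  have hgeom : ∑' n : ℕ, ENNReal.ofReal ((t - 1) * Real.exp (D * t) * (1 / 2) ^ n)
      = ENNReal.ofReal ((t - 1) * Real.exp (D * t) * 2) := by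
    rw [← ENNReal.ofReal_tsum_of_nonneg (fun n => by positivity)
      (summable_geometric_two.mul_left _), tsum_mul_left, tsum_geometric_two]
  calc ∫⁻ X, ENNReal.ofReal (Real.exp (lam * (N X : ℝ) ^ 2)) ∂P
      ≤ ∑' n : ℕ, (P (N ⁻¹' {n}) +
          ENNReal.ofReal ((t - 1) * Real.exp (D * t) * (1 / 2) ^ n)) := by
        rw [hsum]
        exact ENNReal.tsum_le_tsum hterm
    _ = ENNReal.ofReal (1 + (t - 1) * Real.exp (D * t) * 2) := by
        rw [ENNReal.tsum_add, htot, hgeom, ENNReal.ofReal_add zero_le_one (by positivity),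
          ENNReal.ofReal_one]
    _ ≤ ENNReal.ofReal (Real.exp ((D + 2 * Real.exp D) * (t - 1))) := by
        refine ENNReal.ofReal_le_ofReal ?_
        have h1 : 1 ≤ Real.exp (D * (t - 1)) :=
          Real.one_le_exp (mul_nonneg hD (by linarith))
        have h2 : Real.exp (D * t) = Real.exp D * Real.exp (D * (t - 1)) := by
          rw [← Real.exp_add]; congr 1; ring
        calc 1 + (t - 1) * Real.exp (D * t) * 2
            ≤ Real.exp (D * (t - 1)) * (2 * Real.exp D * (t - 1) + 1) := by rw [h2]; linarith
          _ ≤ Real.exp (D * (t - 1)) * Real.exp (2 * Real.exp D * (t - 1)) := by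
              gcongr
              exact Real.add_one_le_exp _
          _ = _ := by rw [← Real.exp_add]; congr 1; ring
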